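/- **Conventions.** An integral quadratic form in $m$ variables is $q(X)=\sum_{1\le i\le j\le m}q_{ij}x_ix_j$ with $q_{ij}\in\mathbb Z$; its matrix is $Q=(q_{ij})+{}^t(q_{ij})$ and $\det q:=\det Q$; $q$ is nonsingular if $\det q\neq 0$. For an integral matrix $A$ put $q[A](Y)=q(AY)$. Let $\Lambda^m=GL_m(\mathbb Z)$, $R(q,q')=\{A \text{ integral}: q[A]=q'\}$, let $R^*(q,q')$ be the set of those $A\in R(q,q')$ whose entries are coprime, and $E(q)=R(q,q)\cap\Lambda^m$. Forms $q,q'$ in $m$ variables are integrally equivalent if $q'=q[U]$ for some $U\in\Lambda^m$; $q'$ is similar to $q$ if $\det q'=\det q$ and $R(q,aq')\ne\emptyset$ for some nonzero integer $a$ prime to $\det q$. A complete system for $q$ is a system of representatives of the different classes of integrally equivalent forms in the similarity class $\{q' : q' \text{ similar to } q\}$. For a prime $p$ and a form $q$ in $m=2k$ variables let $\chi_q(p)=\left(\frac{(-1)^k\det q}{p}\right)$ (Legendre symbol). For integral $m\times m$ matrices $D$ and $A$ and an integer $d$, the isotropic sum $\mathcal S_d(q,D,A)$ is the number of cosets $M\Lambda^m\in\Lambda^mD\Lambda^m/\Lambda^m$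 such that $q[M]\equiv 0 \pmod d$ (all coefficients of $q[M]$ are divisible by $d$) and $A=MY$ for some integral matrix $Y$. **Theorem 6.3.** Let $q$ be a nonsingular integral ternary quadratic form with $\det q=2\Delta$, and let $p$ be a prime not dividing $2\Delta$. Let $\{q_i\}$ be a complete system for $q$. The even subalgebra $C_0$ of the Clifford algebra of $(\mathbb Z^3,q)$ is a free $\mathbb Z$-module of rank $4$, and $x\mapsto x\bar x$ takes integer values on it, where $x\mapsto\bar x$ is the antiautomorphism of the Clifford algebra with $\bar e=-e$ for $e\in\mathbb Z^3$. Let $n$ be the integral quaternary quadratic form given by this norm $x\bar x$ in some $\mathbb Z$-basis of $C_0$, and let $\{n_j\}$ be a complete system for $n$. Then $\chi_n(p)=\left(\frac{(-1)^2\Delta^2}{p}\right)$, the sets $\bigcup_i R^*(q,p^2q_i)/E(q_i)$ and $\bigcup_j R(n,pn_j)/E(n_j)$ are finite, and $$\Bigl|\bigcup_i R^*(q,p^2q_i)/E(q_i)\Bigr| = (1+\chi_n(p))^{-1}\,\Bigl|\bigcup_j R(n,pn_j)/E(n_j)\Bigr| .$$ Moreover, with $O_m$ the zero matrix of order $m$,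 $$\Bigl|\bigcup_i R^*(q,p^2q_i)/E(q_i)\Bigr| = \mathcal S_{p^2}\bigl(q,\operatorname{diag}(1,p,p^2),O_3\bigr)=p+1,\qquad \Bigl|\bigcup_j R(n,pn_j)/E(n_j)\Bigr| = \mathcal S_{p}\bigl(n,\operatorname{diag}(1,1,p,p),O_4\bigr)=2(p+1).$$ -/

import Mathlib

/-! Integral quadratic forms in `m` variables are Mathlib's quadratic forms on `ℤ^m`, i.e. the
homogeneous polynomials `∑_{i ≤ j} q_ij x_i x_j` with arbitrary integer coefficients `q_ij`. -/

noncomputable section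

namespace Automorph

/-- Integral quadratic forms in `m` variables. -/
abbrev IntForm (m : ℕ) : Type := QuadraticForm ℤ (Fin m → ℤ)

/-- The matrix `Q = (q_ij) + (q_ij)ᵗ` of an integral form: the Gram matrix of the bilinear form
`q (x + y) - q x - q y`, so that `2 * q x = xᵗ Q x`. -/
def formMatrix {m : ℕ} (q : IntForm m) : Matrix (Fin m) (Fin m) ℤ :=
  Matrix.of fun i j => QuadraticMap.polar q (Pi.single i 1) (Pi.single j 1)

/-- The determinant of an integral form, i.e. of its matrix. -/
def formDet {m : ℕ} (q : IntForm m) : ℤ := (formMatrix q).det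

/-- The form `q[A]`, `q[A](y) = q(A y)`. -/
def subst {m k : ℕ} (q : IntForm m) (A : Matrix (Fin m) (Fin k) ℤ) : IntForm k :=
  QuadraticMap.comp q (Matrix.mulVecLin A)

/-- `R(q, q')`: the integral representations of `q'` by `q`. -/
def reps {m k : ℕ} (q : IntForm m) (q' : IntForm k) : Set (Matrix (Fin m) (Fin k) ℤ) :=
  {A | subst q A = q'}

/-- `R*(q, q')`: the primitive integral representations, those whose entries are coprime. -/
def primReps {m k : ℕ} (q : IntForm m) (q' : IntForm k) : Set (Matrix (Fin m) (Fin k) ℤ) :=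
  {A | A ∈ reps q q' ∧ ∀ d : ℤ, (∀ i j, d ∣ A i j) → IsUnit d}

/-- `GL_m(ℤ)`, as a set of integral matrices. -/
def intGL (m : ℕ) : Set (Matrix (Fin m) (Fin m) ℤ) := {U | IsUnit U}

/-- `E(q) = R(q, q) ∩ GL_m(ℤ)`: the group of units of `q`. -/
def unitsOf {m : ℕ} (q : IntForm m) : Set (Matrix (Fin m) (Fin m) ℤ) := reps q q ∩ intGL m

/-- Integral equivalence: `q' = q[U]` for some `U ∈ GL_m(ℤ)`. -/
def IntEquivalent {m : ℕ} (q q' : IntForm m) : Prop := ∃ U ∈ intGL m, q' = subst q U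

/-- `q'` is similar to `q`: the determinants are equal and `R(q, a q')` is not empty for some
(nonzero) integer `a` prime to `det q`. -/
def IsSimilar {m : ℕ} (q q' : IntForm m) : Prop :=
  formDet q' = formDet q ∧
    ∃ a : ℤ, a ≠ 0 ∧ IsCoprime a (formDet q) ∧ (reps q (a • q')).Nonempty

/-- The family `f` is a complete system of representatives of the different classes of integrally
equivalent forms in the similarity class of `q`. -/
def IsCompleteSystem {m : ℕ} {ι : Type*} (q : IntForm m) (f : ι → IntForm m) : Prop :=
  (∀ i, IsSimilar q (f i)) ∧ ∀ g, IsSimilar q g → ∃! i, IntEquivalent (f i) g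

/-- The coset `M S = {M U ; U ∈ S}`. -/
def coset {m : ℕ} (M : Matrix (Fin m) (Fin m) ℤ) (S : Set (Matrix (Fin m) (Fin m) ℤ)) :
    Set (Matrix (Fin m) (Fin m) ℤ) :=
  (fun U => M * U) '' S

/-- `⋃ i, R(q, a f_i) / E(f_i)`, as a set of cosets `M E(f_i)`. -/
def automorphClasses {m : ℕ} {ι : Type*} (q : IntForm m) (a : ℤ) (f : ι → IntForm m) :
    Set (Set (Matrix (Fin m) (Fin m) ℤ)) :=
  ⋃ i, {c | ∃ M ∈ reps q (a • f i), c = coset M (unitsOf (f i))}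

/-- `⋃ i, R*(q, a f_i) / E(f_i)`, as a set of cosets `M E(f_i)`. -/
def primAutomorphClasses {m : ℕ} {ι : Type*} (q : IntForm m) (a : ℤ) (f : ι → IntForm m) :
    Set (Set (Matrix (Fin m) (Fin m) ℤ)) :=
  ⋃ i, {c | ∃ M ∈ primReps q (a • f i), c = coset M (unitsOf (f i))}

/-- The cosets `M Λ ∈ Λ D Λ / Λ`, `Λ = GL_m(ℤ)`, with `q[M] ≡ 0 mod d` and `M ∣ A` (that is,
`A = M Y` for an integral matrix `Y`). -/
def isotropicCosets {m k : ℕ} (d : ℤ) (q : IntForm m) (D : Matrix (Fin m) (Fin m) ℤ)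
    (A : Matrix (Fin m) (Fin k) ℤ) : Set (Set (Matrix (Fin m) (Fin m) ℤ)) :=
  {c | ∃ M : Matrix (Fin m) (Fin m) ℤ,
      (∃ U ∈ intGL m, ∃ V ∈ intGL m, M = U * D * V) ∧
      (∃ f : IntForm m, subst q M = d • f) ∧
      (∃ Y : Matrix (Fin m) (Fin k) ℤ, A = M * Y) ∧
      c = coset M (intGL m)}

/-- The isotropic sum `S_d(q, D, A)`, with values in `ℕ∞` so that an infinite sum is `⊤`. -/
def isotropicSum {m k : ℕ} (d : ℤ) (q : IntForm m) (D : Matrix (Fin m) (Fin m) ℤ)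
    (A : Matrix (Fin m) (Fin k) ℤ) : ℕ∞ :=
  (isotropicCosets d q D A).encard

/-- The quadratic character `χ_q(p) = ((-1)^k det q / p)` of a form in `m = 2k` variables. -/
def formChar {m : ℕ} (q : IntForm m) (p : ℕ) [Fact p.Prime] : ℤ :=
  legendreSym p ((-1) ^ (m / 2) * formDet q)

/-- `n` is the norm form of the even Clifford algebra `C₀(ℤ³, q)` in some ℤ-basis `b` of it:
`n(x) = v * v̄` for `v = ∑ x_i b_i`. On a Clifford algebra `star` is the antiautomorphism
`v ↦ v̄` with `ē = -e` for `e ∈ ℤ³`. -/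
def IsEvenNormForm (q : IntForm 3) (n : IntForm 4) : Prop :=
  ∃ b : Module.Basis (Fin 4) ℤ (CliffordAlgebra.even q), ∀ x : Fin 4 → ℤ,
    algebraMap ℤ (CliffordAlgebra q) (n x) =
      ((∑ i, x i • b i : CliffordAlgebra.even q) : CliffordAlgebra q) *
        star ((∑ i, x i • b i : CliffordAlgebra.even q) : CliffordAlgebra q)

end Automorph

end

open Automorph

namespace Automorph

open Matrix

/-! ### Integral forms, their Gram matrices and substitution. -/

section Forms

variable {m k : ℕ}

/-! Sending the class `M E(f_i)` to the coset `M GL_m(ℤ)` turns classes of automorphs into isotropic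
cosets (`encard_classes_eq_isotropicSum`). Two classes with the same coset have equivalent forms,
hence the same index in a complete system. Conversely, if `q[M] = a r` with `det M ^ 2 = a ^ m`,
then `r` has the determinant of `q` and is similar to it, so it is represented in the system.

The double coset is forced. Determinants give `|det M| = p ^ 3` (ternary) or `p ^ 2` (quaternary),
so the elementary divisors are powers of `p`. The columns of `M` modulo `p` span a totally isotropic
subspace, so the rank of `M` modulo `p` is at most half the number of variables. Together with
primitivity in the ternary case, this leaves only `(1, p, p²)` and `(1, 1, p, p)`.

Counting happens over `F_p`, with cosets recorded by their column spaces modulo `p`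
(`isotropicSum_eq_card`). In the quaternary case the lattice is the full preimage of a totally
isotropic plane. In the ternary case each isotropic line lifts to exactly one lattice, consisting of
the vectors that lie on the line modulo `p` and are orthogonal modulo `p²` to a primitive vector on
it. A nonsingular ternary form has `p + 1` isotropic lines (a conic). A quaternary form of nonzero
square determinant is a sum of two hyperbolic planes up to scaling, and its quadric has two rulings,
giving `2 (p + 1)` planes.

The norm form falls under the second case because its determinant is `Δ ^ 2`
(`formDet_of_isEvenNormForm`), computed in the basis `1, e₀e₁, e₀e₂, e₁e₂` of the even Clifford
algebra. Hence its character at `p` is `1`, and `1 + 1` is the ratio of the two counts. -/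

theorem subst_apply (q : IntForm m) (A : Matrix (Fin m) (Fin k) ℤ) (v : Fin k → ℤ) :
    subst q A v = q (A *ᵥ v) := rfl

theorem polar_eq_dotProduct (q : IntForm m) (x y : Fin m → ℤ) :
    QuadraticMap.polar q x y = x ⬝ᵥ formMatrix q *ᵥ y := by
  have hx : x = ∑ i, x i • (Pi.single i 1 : Fin m → ℤ) := by
    ext j; simp [Finset.sum_apply, Pi.single_apply]
  have hy : y = ∑ i, y i • (Pi.single i 1 : Fin m → ℤ) := by
    ext j; simp [Finset.sum_apply, Pi.single_apply]
  have h : QuadraticMap.polarBilin q x y = x ⬝ᵥ formMatrix q *ᵥ y := by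
    conv_lhs => rw [hx, hy]
    simp only [map_sum, map_smul, LinearMap.sum_apply, LinearMap.smul_apply,
      QuadraticMap.polarBilin_apply_apply, dotProduct, mulVec, formMatrix, Matrix.of_apply,
      smul_eq_mul, Finset.mul_sum]
    refine (Finset.sum_comm).trans ?_
    refine Finset.sum_congr rfl fun i _ => Finset.sum_congr rfl fun j _ => ?_
    ring
  exact h

theorem two_mul_form (q : IntForm m) (x : Fin m → ℤ) :
    2 * q x = x ⬝ᵥ formMatrix q *ᵥ x := by
  rw [← polar_eq_dotProduct, QuadraticMap.polar_self, two_nsmul, two_mul]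

theorem form_add (q : IntForm m) (x y : Fin m → ℤ) :
    q (x + y) = q x + q y + x ⬝ᵥ formMatrix q *ᵥ y := by
  rw [← polar_eq_dotProduct, QuadraticMap.polar]; ring

theorem formMatrix_apply (q : IntForm m) (i j : Fin m) : formMatrix q i j =
    QuadraticMap.polar q (Pi.single i 1) (Pi.single j 1) := rfl

theorem formMatrix_isSymm (q : IntForm m) : (formMatrix q).IsSymm := by
  ext i j
  simp [formMatrix_apply, QuadraticMap.polar_comm]

theorem formMatrix_subst (q : IntForm m) (A : Matrix (Fin m) (Fin k) ℤ) :
    formMatrix (subst q A) = Aᵀ * formMatrix q * A := by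
  ext i j
  have : formMatrix (subst q A) i j =
      QuadraticMap.polar q (A *ᵥ Pi.single i 1) (A *ᵥ Pi.single j 1) := by
    rw [formMatrix_apply]
    simp only [QuadraticMap.polar, subst_apply, mulVec_add]
  rw [this, polar_eq_dotProduct, mulVec_single_one, mulVec_single_one, Matrix.mul_assoc]
  rfl

theorem formMatrix_smul (a : ℤ) (q : IntForm m) : formMatrix (a • q) = a • formMatrix q := by
  ext i j
  simp only [formMatrix_apply, Matrix.smul_apply, QuadraticMap.polar, _root_.smul_apply,
    smul_eq_mul]
  ring

theorem formDet_subst (q : IntForm m) (A : Matrix (Fin m) (Fin m) ℤ) :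
    formDet (subst q A) = A.det ^ 2 * formDet q := by
  rw [formDet, formMatrix_subst, det_mul, det_mul, det_transpose, formDet]; ring

theorem formDet_smul (a : ℤ) (q : IntForm m) : formDet (a • q) = a ^ m * formDet q := by
  rw [formDet, formMatrix_smul, det_smul, Fintype.card_fin, formDet]

theorem subst_mul (q : IntForm m) {l : ℕ} (A : Matrix (Fin m) (Fin k) ℤ)
    (B : Matrix (Fin k) (Fin l) ℤ) : subst q (A * B) = subst (subst q A) B := by
  ext v; simp [subst_apply, mulVec_mulVec]

theorem subst_one (q : IntForm m) : subst q 1 = q := by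
  ext v; simp [subst_apply]

theorem subst_smul (a : ℤ) (q : IntForm m) (A : Matrix (Fin m) (Fin k) ℤ) :
    subst (a • q) A = a • subst q A := rfl

theorem smul_form_injective {a : ℤ} (ha : a ≠ 0) {f g : IntForm m} (h : a • f = a • g) :
    f = g := by
  ext v
  have := congrArg (fun q : IntForm m => q v) h
  simpa [ha] using this

/-- A form all of whose values are divisible by `d ≠ 0` is `d` times an integral form. -/
theorem exists_eq_smul_form {d : ℤ} (hd : d ≠ 0) (g : IntForm m) (h : ∀ v, d ∣ g v) :
    ∃ f : IntForm m, g = d • f := by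
  choose f hf using h
  refine ⟨QuadraticMap.ofPolar f (fun a x => ?_) (fun x x' y => ?_) (fun a x y => ?_), ?_⟩
  · apply mul_left_cancel₀ hd
    rw [← hf, QuadraticMap.map_smul, hf, smul_eq_mul, smul_eq_mul]; ring
  · apply mul_left_cancel₀ hd
    have := QuadraticMap.polar_add_left g x x' y
    simp only [QuadraticMap.polar, hf] at this ⊢
    linarith
  · apply mul_left_cancel₀ hd
    have := QuadraticMap.polar_smul_left g a x y
    simp only [QuadraticMap.polar, hf, smul_eq_mul] at this ⊢
    linarith
  · ext v; exact hf v

theorem exists_subst_eq_smul_iff {d : ℤ} (hd : d ≠ 0) (q : IntForm m)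
    (M : Matrix (Fin m) (Fin k) ℤ) :
    (∃ f : IntForm k, subst q M = d • f) ↔ ∀ v, d ∣ q (M *ᵥ v) := by
  constructor
  · rintro ⟨f, hf⟩ v
    rw [← subst_apply, hf]
    exact ⟨f v, rfl⟩
  · exact exists_eq_smul_form hd (subst q M)

end Forms

/-! ### Cosets of unimodular groups, and classes of automorphs as cosets. -/

section Cosets

variable {m : ℕ}

theorem one_mem_intGL : (1 : Matrix (Fin m) (Fin m) ℤ) ∈ intGL m := isUnit_one

theorem intGL_mul {U V : Matrix (Fin m) (Fin m) ℤ} (hU : U ∈ intGL m) (hV : V ∈ intGL m) :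
    U * V ∈ intGL m := IsUnit.mul hU hV

theorem exists_intGL_inv {U : Matrix (Fin m) (Fin m) ℤ} (hU : U ∈ intGL m) :
    ∃ V ∈ intGL m, U * V = 1 ∧ V * U = 1 := by
  obtain ⟨u, rfl⟩ := hU
  exact ⟨↑u⁻¹, u⁻¹.isUnit, by simp, by simp⟩

theorem det_sq_of_mem_intGL {U : Matrix (Fin m) (Fin m) ℤ} (hU : U ∈ intGL m) :
    U.det ^ 2 = 1 := by
  have := (Matrix.isUnit_iff_isUnit_det U).1 hU
  exact Int.isUnit_sq this

theorem coset_mul_intGL (M : Matrix (Fin m) (Fin m) ℤ) {U : Matrix (Fin m) (Fin m) ℤ}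
    (hU : U ∈ intGL m) : coset (M * U) (intGL m) = coset M (intGL m) := by
  obtain ⟨V, hV, h1, h2⟩ := exists_intGL_inv hU
  ext X
  constructor
  · rintro ⟨Y, hY, rfl⟩
    exact ⟨U * Y, intGL_mul hU hY, by simp [Matrix.mul_assoc]⟩
  · rintro ⟨Y, hY, rfl⟩
    refine ⟨V * Y, intGL_mul hV hY, ?_⟩
    simp only [← Matrix.mul_assoc]
    rw [Matrix.mul_assoc M, h1, Matrix.mul_one]

theorem exists_of_coset_eq {M N : Matrix (Fin m) (Fin m) ℤ}
    (h : coset M (intGL m) = coset N (intGL m)) : ∃ U ∈ intGL m, N = M * U := by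
  have : N ∈ coset M (intGL m) := by
    rw [h]; exact ⟨1, one_mem_intGL, by simp⟩
  obtain ⟨U, hU, rfl⟩ := this
  exact ⟨U, hU, rfl⟩

/-- Nonsingular matrices with the same column lattice have the same coset. -/
theorem coset_eq_of_range_le {M N : Matrix (Fin m) (Fin m) ℤ} (hM : M.det ≠ 0)
    (h1 : ∀ v, ∃ w, M *ᵥ v = N *ᵥ w) (h2 : ∀ v, ∃ w, N *ᵥ v = M *ᵥ w) :
    coset M (intGL m) = coset N (intGL m) := by
  have key : ∀ {A B : Matrix (Fin m) (Fin m) ℤ}, (∀ v, ∃ w, A *ᵥ v = B *ᵥ w) →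
      ∃ Y, A = B * Y := by
    intro A B h
    choose f hf using h
    refine ⟨Matrix.of fun i j => f (Pi.single j 1) i, ?_⟩
    ext i j
    have := congrFun (hf (Pi.single j 1)) i
    rw [mulVec_single_one] at this
    simpa [Matrix.mul_apply, mulVec, dotProduct] using this
  obtain ⟨Y, hY⟩ := key h1
  obtain ⟨Z, hZ⟩ := key h2
  -- From `M = N Y` and `N = M Z`, cancelling `det M` makes `Z` unimodular.
  have hZY : Z.det * Y.det = 1 := by
    have h : M.det * (Z.det * Y.det) = M.det * 1 := by
      rw [← mul_assoc, ← det_mul, ← hZ, ← det_mul, ← hY, mul_one]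
    exact mul_left_cancel₀ hM h
  have hu : Z ∈ intGL m := (Matrix.isUnit_iff_isUnit_det Z).2 (IsUnit.of_mul_eq_one _ hZY)
  rw [hZ, coset_mul_intGL _ hu]

end Cosets

/-- The cosets `M E(f_i)` with `M ∈ R(q, a f_i)` satisfying `P` correspond to the isotropic cosets
of `Λ D Λ`. -/
theorem encard_classes_eq_isotropicSum {m : ℕ} {ι : Type*} {q : IntForm m}
    {a : ℤ} (ha : a ≠ 0) (hcop : IsCoprime a (formDet q)) {D : Matrix (Fin m) (Fin m) ℤ}
    (hD : D.det ^ 2 = a ^ m) (P : Matrix (Fin m) (Fin m) ℤ → Prop)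
    (h1 : ∀ M f, formDet f = formDet q → M ∈ reps q (a • f) → P M →
      ∃ U ∈ intGL m, ∃ V ∈ intGL m, M = U * D * V)
    (h2 : ∀ U ∈ intGL m, ∀ V ∈ intGL m, P (U * D * V))
    {f : ι → IntForm m} (hf : IsCompleteSystem q f) :
    (⋃ i, {c | ∃ M, (M ∈ reps q (a • f i) ∧ P M) ∧ c = coset M (unitsOf (f i))}).encard =
      isotropicSum a q D (0 : Matrix (Fin m) (Fin m) ℤ) := by
  -- Right multiplication by `GL_m(ℤ)` enlarges `M E(f_i)` to `M GL_m(ℤ)`; this is the bijection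
  -- sought.
  set g : Set (Matrix (Fin m) (Fin m) ℤ) → Set (Matrix (Fin m) (Fin m) ℤ) :=
    fun c => {X | ∃ M ∈ c, ∃ U ∈ intGL m, X = M * U} with hg
  have hgc : ∀ (M : Matrix (Fin m) (Fin m) ℤ) (r : IntForm m),
      g (coset M (unitsOf r)) = coset M (intGL m) := by
    intro M r
    ext X
    constructor
    · rintro ⟨_, ⟨V, hV, rfl⟩, U, hU, rfl⟩
      exact ⟨V * U, intGL_mul hV.2 hU, by simp [Matrix.mul_assoc]⟩
    · rintro ⟨U, hU, rfl⟩
      exact ⟨M, ⟨1, ⟨subst_one r, one_mem_intGL⟩, by simp⟩, U, hU, rfl⟩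
  set A := ⋃ i, {c | ∃ M, (M ∈ reps q (a • f i) ∧ P M) ∧ c = coset M (unitsOf (f i))} with hA
  have hinj : Set.InjOn g A := by
    intro c hc c' hc' h
    obtain ⟨i, M, ⟨hM, -⟩, rfl⟩ := Set.mem_iUnion.1 hc
    obtain ⟨j, N, ⟨hN, -⟩, rfl⟩ := Set.mem_iUnion.1 hc'
    rw [hgc, hgc] at h
    obtain ⟨U, hU, rfl⟩ := exists_of_coset_eq h
    have hij : subst (f i) U = f j := by
      apply smul_form_injective ha
      rw [← subst_smul, ← show subst q M = a • f i from hM, ← subst_mul]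
      exact hN
    -- `f i` and `f j` are equivalent through `U`, so uniqueness of representatives applies.
    have : i = j := by
      obtain ⟨l, -, hl⟩ := hf.2 (f j) (hf.1 j)
      exact (hl i ⟨U, hU, hij.symm⟩).trans (hl j ⟨1, one_mem_intGL, (subst_one _).symm⟩).symm
    subst this
    obtain ⟨V, hV, hUV, hVU⟩ := exists_intGL_inv hU
    have hij' : subst (f i) V = f i := by
      conv_lhs => rw [← hij]
      rw [← subst_mul, hUV, subst_one]
    ext X
    constructor
    · rintro ⟨Y, hY, rfl⟩
      refine ⟨V * Y, ⟨?_, intGL_mul hV hY.2⟩, ?_⟩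
      · change subst _ _ = _
        rw [subst_mul, hij']; exact hY.1
      · simp only [← Matrix.mul_assoc]
        rw [Matrix.mul_assoc M, hUV, Matrix.mul_one]
    · rintro ⟨Y, hY, rfl⟩
      refine ⟨U * Y, ⟨?_, intGL_mul hU hY.2⟩, by simp [Matrix.mul_assoc]⟩
      change subst _ _ = _
      rw [subst_mul, hij]; exact hY.1
  rw [isotropicSum, ← hinj.encard_image]
  congr 1
  ext c
  constructor
  · rintro ⟨_, hc, rfl⟩
    obtain ⟨i, M, ⟨hM, hP⟩, rfl⟩ := Set.mem_iUnion.1 hc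
    exact ⟨M, h1 M (f i) (hf.1 i).1 hM hP, ⟨f i, hM⟩, ⟨0, by simp⟩, hgc _ _⟩
  · rintro ⟨M, ⟨U, hU, V, hV, rfl⟩, ⟨r, hr⟩, -, rfl⟩
    -- `det D ^ 2 = a ^ m` is what makes the quotient form `r` similar to `q`.
    have hdet : formDet r = formDet q := by
      have h := congrArg formDet hr
      rw [formDet_subst, formDet_smul, det_mul, det_mul, mul_pow, mul_pow,
        det_sq_of_mem_intGL hU, det_sq_of_mem_intGL hV, hD, one_mul, mul_one] at h
      exact (mul_left_cancel₀ (pow_ne_zero _ ha) h).symm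
    obtain ⟨i, ⟨T, hT, hrT⟩, -⟩ := hf.2 r ⟨hdet, a, ha, hcop, _, hr⟩
    obtain ⟨S, hS, hTS, hST⟩ := exists_intGL_inv hT
    have hi : f i = subst r S := by rw [hrT, ← subst_mul, hTS, subst_one]
    refine ⟨coset (U * D * V * S) (unitsOf (f i)), Set.mem_iUnion.2 ⟨i, _, ⟨?_, ?_⟩, rfl⟩, ?_⟩
    · change subst _ _ = _
      rw [subst_mul, hr, hi, subst_smul]
    · rw [Matrix.mul_assoc]; exact h2 _ hU _ (intGL_mul hV hS)
    · rw [hgc, coset_mul_intGL _ hS]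

/-! ### Elementary divisors of integral matrices. -/

section Smith

variable {m : ℕ}

theorem isUnit_toMatrix_basis {ι N : Type*} [Fintype ι] [DecidableEq ι] [AddCommGroup N]
    [Module ℤ N] (b c : Module.Basis ι ℤ N) : IsUnit (b.toMatrix c) :=
  IsUnit.of_mul_eq_one _ (b.toMatrix_mul_toMatrix_flip c)

/-- The image lattice of `M` has a basis `c` with `c i = a i • b i` for some basis `b` of `ℤ^m`. `U`
expresses `b` in the standard basis and `V` expresses the columns of `M` in `c`. -/
theorem exists_smith {M : Matrix (Fin m) (Fin m) ℤ} (hM : M.det ≠ 0) :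
    ∃ U ∈ intGL m, ∃ V ∈ intGL m, ∃ a : Fin m → ℤ, M = U * diagonal a * V := by
  have hinj : Function.Injective M.mulVecLin := by
    rw [injective_iff_map_eq_zero]
    intro v hv
    exact Matrix.eq_zero_of_mulVec_eq_zero hM hv
  let e := LinearEquiv.ofInjective M.mulVecLin hinj
  obtain ⟨b, a, c, h⟩ := Submodule.exists_smith_normal_form_of_rank_eq
    (Pi.basisFun ℤ (Fin m)) (N := LinearMap.range M.mulVecLin) e.symm.finrank_eq
  let c' := (Pi.basisFun ℤ (Fin m)).map e
  refine ⟨(Pi.basisFun ℤ (Fin m)).toMatrix b, isUnit_toMatrix_basis _ _, c.toMatrix c',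
    isUnit_toMatrix_basis _ _, a, ?_⟩
  ext i j
  have h1 : ((c' j : LinearMap.range M.mulVecLin) : Fin m → ℤ) i = M i j := by
    change (M *ᵥ (Pi.basisFun ℤ (Fin m) j)) i = M i j
    rw [Pi.basisFun_apply, mulVec_single_one]; rfl
  rw [← h1, ← c.sum_toMatrix_smul_self c' j, Matrix.mul_apply]
  simp only [Submodule.coe_sum, Submodule.coe_smul, h, Finset.sum_apply, Pi.smul_apply,
    smul_eq_mul, mul_diagonal, Module.Basis.toMatrix_apply, Pi.basisFun_repr]
  exact Finset.sum_congr rfl fun l _ => by ring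

theorem exists_smith_pow {M : Matrix (Fin m) (Fin m) ℤ} {p k : ℕ} (hp : p.Prime)
    (hM : M.det.natAbs = p ^ k) :
    ∃ U ∈ intGL m, ∃ V ∈ intGL m, ∃ e : Fin m → ℕ, ∑ i, e i = k ∧
      M = U * diagonal (fun i => (p : ℤ) ^ e i) * V := by
  have h0 : M.det ≠ 0 := by
    rw [← Int.natAbs_ne_zero, hM]; exact pow_ne_zero _ hp.ne_zero
  obtain ⟨U, hU, V, hV, a, rfl⟩ := exists_smith h0
  have hUd := Int.isUnit_iff_natAbs_eq.1 ((Matrix.isUnit_iff_isUnit_det U).1 hU)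
  have hVd := Int.isUnit_iff_natAbs_eq.1 ((Matrix.isUnit_iff_isUnit_det V).1 hV)
  have hprod : ∏ i, (a i).natAbs = p ^ k := by
    rw [← hM, det_mul, det_mul, Int.natAbs_mul, Int.natAbs_mul, hUd, hVd, det_diagonal, one_mul,
      mul_one]
    exact (map_prod Int.natAbsHom a _).symm
  have he : ∀ i, ∃ e : ℕ, (a i).natAbs = p ^ e := by
    intro i
    have : (a i).natAbs ∣ p ^ k := hprod ▸ Finset.dvd_prod_of_mem _ (Finset.mem_univ i)
    obtain ⟨e, -, he⟩ := (Nat.dvd_prime_pow hp).1 this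
    exact ⟨e, he⟩
  choose e he using he
  -- The signs of the elementary divisors are absorbed into the right factor.
  refine ⟨U, hU, diagonal (fun i => (a i).sign) * V, intGL_mul ?_ hV, e, ?_, ?_⟩
  · refine (Matrix.isUnit_iff_isUnit_det _).2 ?_
    rw [det_diagonal, IsUnit.prod_univ_iff]
    intro i
    have : a i ≠ 0 := by
      rw [← Int.natAbs_ne_zero, he]; exact pow_ne_zero _ hp.ne_zero
    rw [Int.isUnit_iff_natAbs_eq, Int.natAbs_sign_of_ne_zero this]
  · simp only [he, Finset.prod_pow_eq_pow_sum] at hprod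
    exact Nat.pow_right_injective hp.two_le hprod
  · rw [← Matrix.mul_assoc, Matrix.mul_assoc U (diagonal fun i => (p : ℤ) ^ e i),
      diagonal_mul_diagonal]
    congr 3
    ext i
    have : ((p : ℤ) ^ e i) = (a i).natAbs := by rw [he]; push_cast; rfl
    rw [this, mul_comm, Int.sign_mul_natAbs]

theorem smith_permute (σ : Equiv.Perm (Fin m)) {U V : Matrix (Fin m) (Fin m) ℤ}
    (hU : U ∈ intGL m) (hV : V ∈ intGL m) (a : Fin m → ℤ) :
    ∃ U' ∈ intGL m, ∃ V' ∈ intGL m, U * diagonal a * V = U' * diagonal (a ∘ σ) * V' := by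
  refine ⟨U.submatrix (Equiv.refl _) σ, (isUnit_submatrix_equiv _ _).2 hU,
    V.submatrix σ (Equiv.refl _), (isUnit_submatrix_equiv _ _).2 hV, ?_⟩
  rw [← submatrix_diagonal_equiv, submatrix_mul_equiv, submatrix_mul_equiv]
  rfl

end Smith

/-! ### Reduction modulo `p`, rank and isotropy. -/

section Isotropy

variable {m : ℕ} (p : ℕ)

/-- Reduction of integral matrices modulo `p`. -/
def red {k l : ℕ} (A : Matrix (Fin k) (Fin l) ℤ) : Matrix (Fin k) (Fin l) (ZMod p) :=
  A.map (Int.castRingHom (ZMod p))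

theorem red_mul {k l n : ℕ} (A : Matrix (Fin k) (Fin l) ℤ) (B : Matrix (Fin l) (Fin n) ℤ) :
    red p (A * B) = red p A * red p B := Matrix.map_mul

theorem red_transpose {k l : ℕ} (A : Matrix (Fin k) (Fin l) ℤ) :
    red p Aᵀ = (red p A)ᵀ := rfl

theorem det_red (A : Matrix (Fin m) (Fin m) ℤ) : (red p A).det = (A.det : ZMod p) :=
  ((Int.castRingHom (ZMod p)).map_det A).symm

theorem isUnit_det_red {U : Matrix (Fin m) (Fin m) ℤ} (hU : U ∈ intGL m) :
    IsUnit (red p U).det := by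
  rw [det_red]
  exact ((Matrix.isUnit_iff_isUnit_det U).1 hU).map (Int.castRingHom (ZMod p))

theorem red_mulVec {k l : ℕ} (A : Matrix (Fin k) (Fin l) ℤ) (v : Fin l → ℤ) :
    red p A *ᵥ (fun i => (v i : ZMod p)) = fun i => ((A *ᵥ v) i : ZMod p) := by
  ext i
  simp [red, mulVec, dotProduct]

theorem red_eq_zero_iff {k l : ℕ} (A : Matrix (Fin k) (Fin l) ℤ) :
    red p A = 0 ↔ ∀ i j, (p : ℤ) ∣ A i j := by
  rw [← Matrix.ext_iff]
  simp [red, ZMod.intCast_zmod_eq_zero_iff_dvd]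

theorem red_diagonal_pow (e : Fin m → ℕ) : red p (diagonal fun i => (p : ℤ) ^ e i) =
    diagonal fun i => if e i = 0 then 1 else 0 := by
  ext i j
  by_cases h : i = j
  · subst h
    by_cases h0 : e i = 0 <;> simp [red, h0]
  · simp [red, h]

theorem eq_zero_of_rank_eq_zero {K : Type*} [Field K] {k l : ℕ} {A : Matrix (Fin k) (Fin l) K}
    (h : A.rank = 0) : A = 0 := by
  have h1 : A.mulVecLin = 0 := LinearMap.range_eq_bot.1 (Submodule.finrank_eq_zero.1 h)
  ext i j
  have := congrFun (LinearMap.congr_fun h1 (Pi.single j 1)) i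
  rwa [mulVecLin_apply, mulVec_single_one] at this

variable [Fact p.Prime]

/-- Unimodular factors stay invertible modulo `p`, so only the unit elementary divisors contribute
to the rank. -/
theorem rank_red_smith {U V : Matrix (Fin m) (Fin m) ℤ} (hU : U ∈ intGL m) (hV : V ∈ intGL m)
    (e : Fin m → ℕ) : (red p (U * diagonal (fun i => (p : ℤ) ^ e i) * V)).rank =
      (Finset.univ.filter fun i => e i = 0).card := by
  rw [red_mul, red_mul, rank_mul_eq_left_of_isUnit_det _ _ (isUnit_det_red p hV),
    rank_mul_eq_right_of_isUnit_det _ _ (isUnit_det_red p hU), red_diagonal_pow, rank_diagonal,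
    Fintype.card_subtype]
  congr 1
  ext i
  simp

variable {p}

theorem dvd_formMatrix_subst_of_dvd {d : ℤ} {q : IntForm m} {k : ℕ}
    {M : Matrix (Fin m) (Fin k) ℤ} (h : ∀ v, d ∣ q (M *ᵥ v)) (v w : Fin k → ℤ) :
    d ∣ (M *ᵥ v) ⬝ᵥ formMatrix q *ᵥ (M *ᵥ w) := by
  rw [← polar_eq_dotProduct, QuadraticMap.polar, ← mulVec_add]
  exact dvd_sub (dvd_sub (h _) (h _)) (h _)

theorem red_isotropic {q : IntForm m} {k : ℕ} {M : Matrix (Fin m) (Fin k) ℤ}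
    (h : ∀ v, (p : ℤ) ∣ q (M *ᵥ v)) : (red p M)ᵀ * red p (formMatrix q) * red p M = 0 := by
  rw [← red_transpose, ← red_mul, ← red_mul, red_eq_zero_iff]
  intro i j
  have := dvd_formMatrix_subst_of_dvd h (Pi.single i 1) (Pi.single j 1)
  rw [mulVec_single_one, mulVec_single_one] at this
  rwa [Matrix.mul_assoc]

/-- Modulo `p` one has `Mᵀ (Q M) = 0` with `Q` invertible, and two matrices with zero product have
ranks adding up to at most `m`. This is the half-dimension bound for totally isotropic subspaces. -/
theorem two_mul_rank_le {q : IntForm m} (hq : ¬ (p : ℤ) ∣ formDet q)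
    {k : ℕ} {M : Matrix (Fin m) (Fin k) ℤ}
    (h : ∀ v, (p : ℤ) ∣ q (M *ᵥ v)) : 2 * (red p M).rank ≤ m := by
  have h1 := red_isotropic h
  have hu : IsUnit (red p (formMatrix q)).det := by
    rw [det_red, isUnit_iff_ne_zero, Ne, ZMod.intCast_zmod_eq_zero_iff_dvd]
    exact hq
  rw [Matrix.mul_assoc] at h1
  have := rank_add_rank_le_card_of_mul_eq_zero h1
  rw [rank_transpose, rank_mul_eq_right_of_isUnit_det _ _ hu, Fintype.card_fin] at this
  omega

end Isotropy

/-! ### The double cosets that contain the automorphs. -/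

theorem natAbs_det_eq_of_mem_reps {m : ℕ} {q f : IntForm m} (hq : formDet q ≠ 0)
    (hf : formDet f = formDet q) {a : ℤ} {b : ℕ} (hab : a ^ m = (b : ℤ) ^ 2)
    {M : Matrix (Fin m) (Fin m) ℤ} (hM : M ∈ reps q (a • f)) : M.det.natAbs = b := by
  have h := congrArg formDet (show subst q M = a • f from hM)
  rw [formDet_subst, formDet_smul, hf, hab] at h
  have := mul_right_cancel₀ hq h
  have h2 := Int.natAbs_eq_iff_sq_eq.2 this
  simpa using h2

/-- Two positive exponents with sum three can only be one and two, so a finite check suffices. -/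
theorem exists_perm_of_sum_three : ∀ e : Fin 3 → Fin 4, ∑ i, (e i).val = 3 →
    (Finset.univ.filter fun i => (e i).val = 0).card = 1 →
    ∃ σ : Equiv.Perm (Fin 3), ∀ i, (e (σ i)).val = i.val := by decide

theorem exists_perm_of_sum_two : ∀ e : Fin 4 → Fin 3, ∑ i, (e i).val = 2 →
    (Finset.univ.filter fun i => (e i).val = 0).card ≤ 2 →
    ∃ σ : Equiv.Perm (Fin 4), ∀ i, (e (σ i)).val = ![0, 0, 1, 1] i := by
  decide +revert

theorem mem_double_coset_of_primReps {p : ℕ} [Fact p.Prime] {q f : IntForm 3}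
    (hq : ¬ (p : ℤ) ∣ formDet q) (hf : formDet f = formDet q) {M : Matrix (Fin 3) (Fin 3) ℤ}
    (hM : M ∈ primReps q ((p : ℤ) ^ 2 • f)) :
    ∃ U ∈ intGL 3, ∃ V ∈ intGL 3, M = U * diagonal ![1, (p : ℤ), (p : ℤ) ^ 2] * V := by
  have hp : p.Prime := Fact.out
  have hq0 : formDet q ≠ 0 := fun h => hq (h ▸ dvd_zero _)
  have hdet := natAbs_det_eq_of_mem_reps (b := p ^ 3) hq0 hf (by push_cast; ring) hM.1
  obtain ⟨U, hU, V, hV, e, he, rfl⟩ := exists_smith_pow hp hdet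
  have hiso : ∀ v, (p : ℤ) ∣ q ((U * diagonal (fun i => (p : ℤ) ^ e i) * V) *ᵥ v) :=
    fun v => (dvd_pow_self _ two_ne_zero).trans
      ((exists_subst_eq_smul_iff (pow_ne_zero 2 (by exact_mod_cast hp.ne_zero)) q _).1
        ⟨f, hM.1⟩ v)
  have hrank := two_mul_rank_le hq hiso
  rw [rank_red_smith p hU hV] at hrank
  -- Rank zero would mean that `p` divides every entry, against primitivity; so the rank is exactly
  -- one.
  have hpos : (Finset.univ.filter fun i => e i = 0).card ≠ 0 := by
    intro h0
    rw [← rank_red_smith p hU hV] at h0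
    have := hM.2 p ((red_eq_zero_iff _ _).1 (eq_zero_of_rank_eq_zero h0))
    rw [Int.isUnit_iff_natAbs_eq, Int.natAbs_natCast] at this
    exact hp.one_lt.ne' this
  have hlt : ∀ i, e i < 4 := fun i => by
    have := Finset.single_le_sum (f := e) (fun _ _ => Nat.zero_le _) (Finset.mem_univ i)
    omega
  obtain ⟨σ, hσ⟩ := exists_perm_of_sum_three (fun i => ⟨e i, hlt i⟩) he (by
    change (Finset.univ.filter fun i => e i = 0).card = 1
    omega)
  obtain ⟨U', hU', V', hV', h⟩ := smith_permute σ hU hV (fun i => (p : ℤ) ^ e i)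
  refine ⟨U', hU', V', hV', h.trans ?_⟩
  congr 3
  ext i
  have := hσ i
  fin_cases i <;> simp_all

theorem mem_double_coset_of_reps {p : ℕ} [Fact p.Prime] {n f : IntForm 4}
    (hn : ¬ (p : ℤ) ∣ formDet n) (hf : formDet f = formDet n) {M : Matrix (Fin 4) (Fin 4) ℤ}
    (hM : M ∈ reps n ((p : ℤ) • f)) :
    ∃ U ∈ intGL 4, ∃ V ∈ intGL 4, M = U * diagonal ![1, 1, (p : ℤ), (p : ℤ)] * V := by
  have hp : p.Prime := Fact.out
  have hn0 : formDet n ≠ 0 := fun h => hn (h ▸ dvd_zero _)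
  have hdet := natAbs_det_eq_of_mem_reps (b := p ^ 2) hn0 hf (by push_cast; ring) hM
  obtain ⟨U, hU, V, hV, e, he, rfl⟩ := exists_smith_pow hp hdet
  have hiso : ∀ v, (p : ℤ) ∣ n ((U * diagonal (fun i => (p : ℤ) ^ e i) * V) *ᵥ v) :=
    fun v => (exists_subst_eq_smul_iff (by exact_mod_cast hp.ne_zero) n _).1 ⟨f, hM⟩ v
  have hrank := two_mul_rank_le hn hiso
  rw [rank_red_smith p hU hV] at hrank
  have hlt : ∀ i, e i < 3 := fun i => by
    have := Finset.single_le_sum (f := e) (fun _ _ => Nat.zero_le _) (Finset.mem_univ i)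
    omega
  obtain ⟨σ, hσ⟩ := exists_perm_of_sum_two (fun i => ⟨e i, hlt i⟩) he (by
    change (Finset.univ.filter fun i => e i = 0).card ≤ 2
    omega)
  obtain ⟨U', hU', V', hV', h⟩ := smith_permute σ hU hV (fun i => (p : ℤ) ^ e i)
  refine ⟨U', hU', V', hV', h.trans ?_⟩
  congr 3
  ext i
  have := hσ i
  fin_cases i <;> simp_all

/-! ### Normal forms of quadratic forms over finite fields of odd characteristic. -/

section FiniteField

variable {F : Type*} [Field F]

theorem exists_diagonalization (h2 : (2 : F) ≠ 0) {m : ℕ} {S : Matrix (Fin m) (Fin m) F}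
    (hS : S.IsSymm) : ∃ (P : Matrix (Fin m) (Fin m) F) (w : Fin m → F),
      Pᵀ * S * P = diagonal w ∧ P.det ≠ 0 := by
  have : Invertible (2 : F) := invertibleOfNonzero h2
  have hB : LinearMap.IsSymm (Matrix.toBilin' S) := ⟨fun x y => by
    rw [Matrix.toBilin'_apply', Matrix.toBilin'_apply', dotProduct_mulVec, ← mulVec_transpose,
      hS.eq, dotProduct_comm]; rfl⟩
  obtain ⟨v, hv⟩ := LinearMap.BilinForm.exists_orthogonal_basis (V := Fin m → F)
    (B := Matrix.toBilin' S) hB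
  let b := v.reindex (finCongr (Module.finrank_fin_fun F))
  have hb : ∀ i j, i ≠ j → Matrix.toBilin' S (b i) (b j) = 0 := fun i j hij => by
    simp only [b, Module.Basis.reindex_apply]
    exact hv (fun h => hij (by simpa using h))
  let P := (Pi.basisFun F (Fin m)).toMatrix b
  have hcol : ∀ j, P.col j = b j := fun j => by ext i; simp [P, Module.Basis.toMatrix_apply]
  refine ⟨P, fun i => Matrix.toBilin' S (b i) (b i), ?_, ?_⟩
  · ext i j
    have : (Pᵀ * S * P) i j = Matrix.toBilin' S (b i) (b j) := by
      rw [Matrix.toBilin'_apply', ← hcol i, ← hcol j, Matrix.mul_assoc]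
      rfl
    rw [this]
    by_cases hij : i = j
    · subst hij; simp
    · rw [diagonal_apply_ne _ hij, hb i j hij]
  · have hu : IsUnit P := IsUnit.of_mul_eq_one _
      ((Pi.basisFun F (Fin m)).toMatrix_mul_toMatrix_flip b)
    exact ((Matrix.isUnit_iff_isUnit_det P).1 hu).ne_zero

/-- By pigeonhole: the values of `a s²` and of `c - b t²` each fill more than half of the field. -/
theorem exists_binary_rep [Fintype F] (h2 : (2 : F) ≠ 0) {a b : F} (ha : a ≠ 0) (hb : b ≠ 0)
    (c : F) : ∃ s t : F, a * s ^ 2 + b * t ^ 2 = c := by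
  have hodd : Fintype.card F % 2 = 1 :=
    FiniteField.odd_card_of_char_ne_two fun h => h2 (by
      have := ringChar.Nat.cast_ringChar (R := F)
      rw [h] at this
      exact_mod_cast this)
  have hda : (Polynomial.C a * Polynomial.X ^ 2 - Polynomial.C c).degree = 2 := by
    rw [Polynomial.degree_sub_C, Polynomial.degree_C_mul_X_pow 2 ha]; rfl
    rw [Polynomial.degree_C_mul_X_pow 2 ha]; decide
  obtain ⟨s, t, h⟩ := FiniteField.exists_root_sum_quadratic hda
    (Polynomial.degree_C_mul_X_pow 2 hb) hodd
  simp only [Polynomial.eval_sub, Polynomial.eval_mul, Polynomial.eval_C, Polynomial.eval_pow,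
    Polynomial.eval_X] at h
  exact ⟨s, t, by linear_combination h⟩

theorem det_ne_zero_of_gram {m : ℕ} {P S G : Matrix (Fin m) (Fin m) F} (h : Pᵀ * S * P = G)
    (hG : G.det ≠ 0) : P.det ≠ 0 := by
  intro h0
  rw [← h, det_mul, h0, mul_zero] at hG
  exact hG rfl

/-- If `w₀ s² + w₁ t² = -w₂`, then `(s, t, 1)` and `(s, t, -1)` are isotropic with product `-2 w₂`,
and `(-w₁ t, w₀ s, 0)` is orthogonal to both. -/
theorem exists_hyperbolic_three [Fintype F] (h2 : (2 : F) ≠ 0) {S : Matrix (Fin 3) (Fin 3) F}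
    (hS : S.IsSymm) (hdet : S.det ≠ 0) : ∃ (P : Matrix (Fin 3) (Fin 3) F) (h d : F),
      Pᵀ * S * P = !![0, h, 0; h, 0, 0; 0, 0, d] ∧ P.det ≠ 0 ∧ h ≠ 0 ∧ d ≠ 0 := by
  obtain ⟨P, w, hP, hPd⟩ := exists_diagonalization h2 hS
  have hw : (diagonal w).det ≠ 0 := by
    rw [← hP, det_mul, det_mul, det_transpose]
    exact mul_ne_zero (mul_ne_zero hPd hdet) hPd
  rw [det_diagonal, Fin.prod_univ_three] at hw
  have hw0 : w 0 ≠ 0 := fun h => hw (by simp [h])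
  have hw1 : w 1 ≠ 0 := fun h => hw (by simp [h])
  have hw2 : w 2 ≠ 0 := fun h => hw (by simp [h])
  obtain ⟨s, t, hst⟩ := exists_binary_rep h2 hw0 hw1 (-w 2)
  have hgram : (P * !![s, s, -w 1 * t; t, t, w 0 * s; 1, -1, 0])ᵀ * S *
      (P * !![s, s, -w 1 * t; t, t, w 0 * s; 1, -1, 0]) =
      !![0, -2 * w 2, 0; -2 * w 2, 0, 0; 0, 0, -(w 0 * w 1 * w 2)] := by
    have hdw : diagonal w = !![w 0, 0, 0; 0, w 1, 0; 0, 0, w 2] := by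
      ext i j; fin_cases i <;> fin_cases j <;> rfl
    rw [transpose_mul]
    have : ∀ A : Matrix (Fin 3) (Fin 3) F, Aᵀ * Pᵀ * S * (P * A) = Aᵀ * (Pᵀ * S * P) * A :=
      fun A => by simp only [Matrix.mul_assoc]
    rw [this, hP, hdw]
    ext i j
    fin_cases i <;> fin_cases j <;> simp [Matrix.mul_apply, Fin.sum_univ_three]
    · linear_combination hst
    · linear_combination hst
    · ring
    · linear_combination hst
    · linear_combination hst
    · ring
    · ring
    · ring
    · linear_combination w 0 * w 1 * hst
  refine ⟨_, _, _, hgram, det_ne_zero_of_gram hgram ?_, ?_, ?_⟩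
  · rw [det_fin_three]
    simp [hw0, hw1, hw2, h2]
  · simp [hw2, h2]
  · simp [hw0, hw1, hw2]

/-- A hyperbolic plane splits off as in the ternary case. The square determinant makes its
complement hyperbolic too, and rescaling gives both planes the same constant `h`. -/
theorem exists_hyperbolic_four [Fintype F] (h2 : (2 : F) ≠ 0) {S : Matrix (Fin 4) (Fin 4) F}
    (hS : S.IsSymm) {δ : F} (hdet : S.det = δ ^ 2) (hδ : δ ≠ 0) :
    ∃ (P : Matrix (Fin 4) (Fin 4) F) (h : F),
      Pᵀ * S * P = !![0, h, 0, 0; h, 0, 0, 0; 0, 0, 0, h; 0, 0, h, 0] ∧ P.det ≠ 0 ∧ h ≠ 0 := by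
  obtain ⟨P, w, hP, hPd⟩ := exists_diagonalization h2 hS
  have hw : (diagonal w).det = (P.det * δ) ^ 2 := by
    rw [← hP, det_mul, det_mul, det_transpose, hdet]; ring
  obtain ⟨E, hE, hE0⟩ : ∃ E, w 0 * w 1 * w 2 * w 3 = E ^ 2 ∧ E ≠ 0 := by
    rw [det_diagonal, Fin.prod_univ_four] at hw
    exact ⟨_, hw, mul_ne_zero hPd hδ⟩
  have hw : w 0 * w 1 * w 2 * w 3 ≠ 0 := hE ▸ pow_ne_zero 2 hE0
  have hw0 : w 0 ≠ 0 := fun h => hw (by simp [h])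
  have hw1 : w 1 ≠ 0 := fun h => hw (by simp [h])
  have hw2 : w 2 ≠ 0 := fun h => hw (by simp [h])
  have hw3 : w 3 ≠ 0 := fun h => hw (by simp [h])
  obtain ⟨s, t, hst⟩ := exists_binary_rep h2 hw0 hw1 (-w 2)
  -- The vector `(-w₁ t, w₀ s, 0, 0)` has norm `-w₀ w₁ w₂`. This `r` gives `(0, 0, 0, r)` the
  -- opposite norm, so their sum and difference are isotropic.
  obtain ⟨r, hr⟩ : ∃ r, w 3 * r ^ 2 = w 0 * w 1 * w 2 := by
    refine ⟨E / w 3, ?_⟩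
    rw [div_pow, ← hE]; field_simp
  -- Scaling the difference by `k` turns the product `-2 w₀ w₁ w₂` into `-2 w₂`, as in the first
  -- plane.
  obtain ⟨k, hk⟩ : ∃ k, k * (w 0 * w 1) = 1 := ⟨_, inv_mul_cancel₀ (mul_ne_zero hw0 hw1)⟩
  set A := !![s, s, -w 1 * t, k * (-w 1 * t); t, t, w 0 * s, k * (w 0 * s); 1, -1, 0, 0;
    0, 0, r, -k * r] with hA
  have hgram : (P * A)ᵀ * S * (P * A) =
      !![0, -2 * w 2, 0, 0; -2 * w 2, 0, 0, 0; 0, 0, 0, -2 * w 2; 0, 0, -2 * w 2, 0] := by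
    have hdw : diagonal w = !![w 0, 0, 0, 0; 0, w 1, 0, 0; 0, 0, w 2, 0; 0, 0, 0, w 3] := by
      ext i j; fin_cases i <;> fin_cases j <;> rfl
    have : (P * A)ᵀ * S * (P * A) = Aᵀ * (Pᵀ * S * P) * A := by
      rw [transpose_mul]; simp only [Matrix.mul_assoc]
    rw [this, hP, hdw, hA]
    ext i j
    fin_cases i <;> fin_cases j <;> simp [Matrix.mul_apply, Fin.sum_univ_four]
    · linear_combination hst
    · linear_combination hst
    · ring
    · ring
    · linear_combination hst
    · linear_combination hst
    · ring
    · ring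
    · ring
    · ring
    · linear_combination w 0 * w 1 * hst + hr
    · linear_combination w 0 * w 1 * k * hst - k * hr - 2 * w 2 * hk
    · ring
    · ring
    · linear_combination w 0 * w 1 * k * hst - k * hr - 2 * w 2 * hk
    · linear_combination w 0 * w 1 * k ^ 2 * hst + k ^ 2 * hr
  have hh : -2 * w 2 ≠ 0 := by simp [hw2, h2]
  refine ⟨_, _, hgram, det_ne_zero_of_gram hgram ?_, hh⟩
  generalize -2 * w 2 = h at hh
  have : (!![0, h, 0, 0; h, 0, 0, 0; 0, 0, 0, h; 0, 0, h, 0]).det = h ^ 4 := by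
    rw [det_succ_row_zero]
    simp [Fin.sum_univ_succ, det_fin_three, Fin.succAbove, submatrix]
    try ring
  rw [this]
  exact pow_ne_zero 4 hh

end FiniteField

/-! ### Isotropic lines on a conic and planes on a split quadric. -/

section IsotropicSubspaces

variable {F : Type*} [Field F]

theorem dotProduct_gram {m : ℕ} {P S G : Matrix (Fin m) (Fin m) F} (h : Pᵀ * S * P = G)
    (x y : Fin m → F) : (P *ᵥ x) ⬝ᵥ S *ᵥ (P *ᵥ y) = x ⬝ᵥ G *ᵥ y := by
  rw [← h, ← mulVec_mulVec, ← mulVec_mulVec, dotProduct_mulVec x, vecMul_transpose]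

theorem exists_mulVec_eq {m : ℕ} {P : Matrix (Fin m) (Fin m) F} (hP : P.det ≠ 0)
    (y : Fin m → F) : ∃ x, y = P *ᵥ x :=
  ⟨P⁻¹ *ᵥ y, by rw [mulVec_mulVec, Matrix.mul_nonsing_inv _ (isUnit_iff_ne_zero.2 hP),
    one_mulVec]⟩

theorem mulVec_injective_of_det {m : ℕ} {P : Matrix (Fin m) (Fin m) F} (hP : P.det ≠ 0) :
    Function.Injective (P *ᵥ ·) :=
  Matrix.mulVec_injective_of_isUnit
    ((Matrix.isUnit_iff_isUnit_det P).2 (isUnit_iff_ne_zero.2 hP))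

/-- The isotropic lines of a nonsingular ternary form over a finite field of odd characteristic
are parametrized by the projective line. -/
theorem exists_isotropic_lines [Fintype F] (h2 : (2 : F) ≠ 0) {S : Matrix (Fin 3) (Fin 3) F}
    (hS : S.IsSymm) (hdet : S.det ≠ 0) : ∃ x : Option F → Fin 3 → F, (∀ t, x t ≠ 0) ∧
      (∀ t, x t ⬝ᵥ S *ᵥ x t = 0) ∧ (∀ y, y ⬝ᵥ S *ᵥ y = 0 → ∃ t, ∃ c : F, y = c • x t) ∧
      Function.Injective fun t => Submodule.span F {x t} := by
  obtain ⟨P, h, d, hP, hPd, hh, hd⟩ := exists_hyperbolic_three h2 hS hdet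
  have hform : ∀ z : Fin 3 → F, (P *ᵥ z) ⬝ᵥ S *ᵥ (P *ᵥ z) =
      2 * h * z 0 * z 1 + d * z 2 ^ 2 := fun z => by
    rw [dotProduct_gram hP]
    simp [dotProduct, mulVec, Fin.sum_univ_three]
    ring
  -- Points of the conic `2 h z₀ z₁ + d z₂² = 0`: the single point with `z₀ = 0`, and the affine
  -- points normalised by `z₀ = 1`.
  let z : Option F → Fin 3 → F := fun t => t.elim ![0, 1, 0] fun t => ![1, -d * t ^ 2 / (2 * h), t]
  have hz : ∀ t, z t ≠ 0 := by
    rintro (_ | t) h0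
    · simpa [z] using congrFun h0 1
    · simpa [z] using congrFun h0 0
  refine ⟨fun t => P *ᵥ z t, fun t h0 => hz t (mulVec_injective_of_det hPd ?_), ?_, ?_, ?_⟩
  · simpa using h0
  · rintro (_ | t)
    · simp only [hform, z, Option.elim]
      simp
    · simp only [hform, z, Option.elim]
      simp
      field_simp
      ring
  · intro y hy
    obtain ⟨x, rfl⟩ := exists_mulVec_eq hPd y
    rw [hform] at hy
    by_cases hx : x 0 = 0
    · have hx2 : x 2 = 0 := by simpa [hx, hd] using hy
      refine ⟨none, x 1, ?_⟩
      rw [← mulVec_smul]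
      congr 1
      ext i; fin_cases i <;> simp [z, hx, hx2]
    · refine ⟨some (x 2 / x 0), x 0, ?_⟩
      rw [← mulVec_smul]
      congr 1
      ext i; fin_cases i
      · simp [z]
      · simp [z]
        field_simp
        linear_combination hy
      · simp [z]
        field_simp
  · intro t t' htt'
    simp only at htt'
    have hmem : P *ᵥ z t ∈ Submodule.span F {P *ᵥ z t'} := by
      rw [← htt']; exact Submodule.mem_span_singleton_self _
    obtain ⟨c, hc⟩ := Submodule.mem_span_singleton.1 hmem
    rw [← mulVec_smul] at hc
    have hc := mulVec_injective_of_det hPd hc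
    have hc0 := congrFun hc 0
    have hc1 := congrFun hc 1
    have hc2 := congrFun hc 2
    rcases t with _ | t <;> rcases t' with _ | t' <;> simp [z] at hc0 hc1 hc2
    · rfl
    · simp [hc0] at hc1
    · simp [hc0] at hc2
      rw [hc2]

/-- The planes on which `y₀ y₁ + y₂ y₃` vanishes, in their standard parametrization. -/
def stdPlane (F : Type*) [Field F] : Option F ⊕ Option F → Submodule F (Fin 4 → F)
  | .inl none => LinearMap.range (!![1, 0; 0, 0; 0, 0; 0, 1] : Matrix (Fin 4) (Fin 2) F).mulVecLin
  | .inl (some t) =>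
    LinearMap.range (!![t, 0; 0, 1; 1, 0; 0, -t] : Matrix (Fin 4) (Fin 2) F).mulVecLin
  | .inr none => LinearMap.range (!![1, 0; 0, 0; 0, 1; 0, 0] : Matrix (Fin 4) (Fin 2) F).mulVecLin
  | .inr (some t) =>
    LinearMap.range (!![t, 0; 0, 1; 0, -t; 1, 0] : Matrix (Fin 4) (Fin 2) F).mulVecLin

theorem mem_stdPlane_inl_none {y : Fin 4 → F} :
    y ∈ stdPlane F (.inl none) ↔ y 1 = 0 ∧ y 2 = 0 := by
  constructor
  · rintro ⟨x, rfl⟩; simp [mulVec, dotProduct]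
  · rintro ⟨h1, h2⟩
    refine ⟨![y 0, y 3], ?_⟩
    ext i; fin_cases i <;> simp [mulVec, dotProduct, h1, h2]

theorem mem_stdPlane_inr_none {y : Fin 4 → F} :
    y ∈ stdPlane F (.inr none) ↔ y 1 = 0 ∧ y 3 = 0 := by
  constructor
  · rintro ⟨x, rfl⟩; simp [mulVec, dotProduct]
  · rintro ⟨h1, h2⟩
    refine ⟨![y 0, y 2], ?_⟩
    ext i; fin_cases i <;> simp [mulVec, dotProduct, h1, h2]

theorem mem_stdPlane_inl_some {t : F} {y : Fin 4 → F} :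
    y ∈ stdPlane F (.inl (some t)) ↔ y 0 = t * y 2 ∧ y 3 = -t * y 1 := by
  constructor
  · rintro ⟨x, rfl⟩; simp [mulVec, dotProduct]
  · rintro ⟨h1, h2⟩
    refine ⟨![y 2, y 1], ?_⟩
    ext i; fin_cases i <;> simp [mulVec, dotProduct, h1, h2]

theorem mem_stdPlane_inr_some {t : F} {y : Fin 4 → F} :
    y ∈ stdPlane F (.inr (some t)) ↔ y 0 = t * y 3 ∧ y 2 = -t * y 1 := by
  constructor
  · rintro ⟨x, rfl⟩; simp [mulVec, dotProduct]
  · rintro ⟨h1, h2⟩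
    refine ⟨![y 3, y 1], ?_⟩
    ext i; fin_cases i <;> simp [mulVec, dotProduct, h1, h2]

theorem finrank_range_mulVecLin_two {A : Matrix (Fin 4) (Fin 2) F} (i j : Fin 4)
    (hi : A i = ![1, 0]) (hj : A j = ![0, 1] ) :
    Module.finrank F (LinearMap.range A.mulVecLin) = 2 := by
  rw [LinearMap.finrank_range_of_inj, Module.finrank_fin_fun]
  rw [injective_iff_map_eq_zero]
  intro x hx
  have h1 := congrFun hx i
  have h2 := congrFun hx j
  simp only [mulVecLin_apply, mulVec, hi, hj] at h1 h2
  ext k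
  fin_cases k
  · simpa [dotProduct] using h1
  · simpa [dotProduct] using h2

theorem finrank_stdPlane (t : Option F ⊕ Option F) :
    Module.finrank F (stdPlane F t) = 2 := by
  rcases t with (_ | t) | (_ | t)
  · exact finrank_range_mulVecLin_two 0 3 rfl rfl
  · exact finrank_range_mulVecLin_two 2 1 rfl rfl
  · exact finrank_range_mulVecLin_two 0 2 rfl rfl
  · exact finrank_range_mulVecLin_two 3 1 rfl rfl

theorem isotropic_of_mem_stdPlane {t : Option F ⊕ Option F} {y : Fin 4 → F}
    (h : y ∈ stdPlane F t) : y 0 * y 1 + y 2 * y 3 = 0 := by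
  rcases t with (_ | t) | (_ | t)
  · rw [mem_stdPlane_inl_none] at h; simp [h]
  · rw [mem_stdPlane_inl_some] at h; rw [h.1, h.2]; ring
  · rw [mem_stdPlane_inr_none] at h; simp [h]
  · rw [mem_stdPlane_inr_some] at h; rw [h.1, h.2]; ring

theorem stdPlane_injective : Function.Injective (stdPlane F) := by
  intro s t h
  have key : ∀ y, y ∈ stdPlane F s ↔ y ∈ stdPlane F t := fun y => by rw [h]
  rcases s with (_ | s) | (_ | s) <;> rcases t with (_ | t) | (_ | t) <;>
    simp only [mem_stdPlane_inl_none, mem_stdPlane_inr_none, mem_stdPlane_inl_some,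
      mem_stdPlane_inr_some] at key
  · rfl
  · simpa using key ![1, 0, 0, 0]
  · simpa using key ![0, 0, 0, 1]
  · simpa using key ![1, 0, 0, 0]
  · simpa using key ![1, 0, 0, 0]
  · have := key ![s, 0, 1, 0]
    simp at this
    rw [this]
  · simpa using key ![0, 1, 0, -s]
  · simpa using key ![s, 0, 1, 0]
  · simpa using key ![0, 0, 1, 0]
  · simpa using key ![1, 0, 0, 0]
  · rfl
  · simpa using key ![1, 0, 0, 0]
  · simpa using key ![1, 0, 0, 0]
  · simpa using key ![s, 0, 0, 1]
  · simpa using key ![1, 0, 0, 0]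
  · have := key ![s, 0, 0, 1]
    simp at this
    rw [this]

/-- A nonzero `z ∈ W` with `z 1 = 0` satisfies `z 2 * z 3 = 0`, which sorts the planes into cases.
Orthogonality to `z` gives one linear equation on `W`, and a second suitable vector of `W` gives the
other. -/
theorem exists_stdPlane_eq {W : Submodule F (Fin 4 → F)}
    (hW : Module.finrank F W = 2) (hiso : ∀ y ∈ W, y 0 * y 1 + y 2 * y 3 = 0) :
    ∃ t, W = stdPlane F t := by
  suffices ∃ t, W ≤ stdPlane F t by
    obtain ⟨t, ht⟩ := this
    exact ⟨t, Submodule.eq_of_le_of_finrank_eq ht (hW.trans (finrank_stdPlane t).symm)⟩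
  have hbil : ∀ x ∈ W, ∀ y ∈ W, x 0 * y 1 + x 1 * y 0 + x 2 * y 3 + x 3 * y 2 = 0 := by
    intro x hx y hy
    have := hiso _ (W.add_mem hx hy)
    simp only [Pi.add_apply] at this
    linear_combination this - hiso x hx - hiso y hy
  -- A linear functional on a plane has a nonzero kernel.
  obtain ⟨z, hzW, hz0, hz1⟩ : ∃ z ∈ W, z ≠ 0 ∧ z 1 = 0 := by
    let φ : W →ₗ[F] F := (LinearMap.proj 1).comp W.subtype
    have hk : LinearMap.ker φ ≠ ⊥ := by
      apply LinearMap.ker_ne_bot_of_finrank_lt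
      rw [hW, Module.finrank_self]; norm_num
    obtain ⟨z, hz, hz0⟩ := (Submodule.ne_bot_iff _).1 hk
    exact ⟨z, z.2, fun h => hz0 (Subtype.ext h), hz⟩
  by_cases hz2 : z 2 = 0
  · by_cases hz3 : z 3 = 0
    · have hz00 : z 0 ≠ 0 := fun h => hz0 (by ext i; fin_cases i <;> simp [*])
      have hy1 : ∀ y ∈ W, y 1 = 0 := fun y hy => by
        simpa [hz1, hz2, hz3, hz00] using hbil z hzW y hy
      by_cases h : ∀ y ∈ W, y 2 = 0
      · exact ⟨.inl none, fun y hy => mem_stdPlane_inl_none.2 ⟨hy1 y hy, h y hy⟩⟩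
      · push Not at h
        obtain ⟨x, hx, hx2⟩ := h
        have hx3 : x 3 = 0 := by simpa [hy1 x hx, hx2] using hiso x hx
        exact ⟨.inr none, fun y hy => mem_stdPlane_inr_none.2 ⟨hy1 y hy, by
          simpa [hy1 x hx, hy1 y hy, hx3, hx2] using hbil x hx y hy⟩⟩
    · have hd : ∀ y ∈ W, y 2 = -(z 0 / z 3) * y 1 := fun y hy => by
        have := hbil z hzW y hy
        rw [hz1, hz2] at this
        field_simp
        linear_combination this
      by_cases h : ∀ y ∈ W, y 1 = 0
      · exact ⟨.inl none, fun y hy => mem_stdPlane_inl_none.2 ⟨h y hy, by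
          rw [hd y hy, h y hy, mul_zero]⟩⟩
      · push Not at h
        obtain ⟨w, hw, hw1⟩ := h
        have hwa : w 0 = z 0 / z 3 * w 3 := by
          have := hiso w hw
          rw [hd w hw] at this
          apply mul_right_cancel₀ hw1
          linear_combination this
        refine ⟨.inr (some (z 0 / z 3)), fun y hy => mem_stdPlane_inr_some.2 ⟨?_, hd y hy⟩⟩
        have := hbil w hw y hy
        rw [hwa, hd w hw, hd y hy] at this
        apply mul_left_cancel₀ hw1
        linear_combination this
  · have hz3 : z 3 = 0 := by simpa [hz1, hz2] using hiso z hzW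
    have hd : ∀ y ∈ W, y 3 = -(z 0 / z 2) * y 1 := fun y hy => by
      have := hbil z hzW y hy
      rw [hz1, hz3] at this
      field_simp
      linear_combination this
    by_cases h : ∀ y ∈ W, y 1 = 0
    · exact ⟨.inr none, fun y hy => mem_stdPlane_inr_none.2 ⟨h y hy, by
        rw [hd y hy, h y hy, mul_zero]⟩⟩
    · push Not at h
      obtain ⟨w, hw, hw1⟩ := h
      have hwa : w 0 = z 0 / z 2 * w 2 := by
        have := hiso w hw
        rw [hd w hw] at this
        apply mul_right_cancel₀ hw1
        linear_combination this
      refine ⟨.inl (some (z 0 / z 2)), fun y hy => mem_stdPlane_inl_some.2 ⟨?_, hd y hy⟩⟩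
      have := hbil w hw y hy
      rw [hwa, hd w hw, hd y hy] at this
      apply mul_left_cancel₀ hw1
      linear_combination this

/-- The totally isotropic planes of a quaternary form of square determinant over a finite field of
odd characteristic are parametrized by two projective lines. -/
theorem exists_isotropic_planes [Fintype F] (h2 : (2 : F) ≠ 0) {S : Matrix (Fin 4) (Fin 4) F}
    (hS : S.IsSymm) {δ : F} (hdet : S.det = δ ^ 2) (hδ : δ ≠ 0) :
    ∃ W : Option F ⊕ Option F → Submodule F (Fin 4 → F), Function.Injective W ∧
      (∀ t, Module.finrank F (W t) = 2) ∧ (∀ t, ∀ y ∈ W t, y ⬝ᵥ S *ᵥ y = 0) ∧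
      ∀ V : Submodule F (Fin 4 → F), Module.finrank F V = 2 → (∀ y ∈ V, y ⬝ᵥ S *ᵥ y = 0) →
        ∃ t, V = W t := by
  obtain ⟨P, h, hP, hPd, hh⟩ := exists_hyperbolic_four h2 hS hdet hδ
  have hform : ∀ z : Fin 4 → F, (P *ᵥ z) ⬝ᵥ S *ᵥ (P *ᵥ z) =
      2 * h * (z 0 * z 1 + z 2 * z 3) := fun z => by
    rw [dotProduct_gram hP]
    simp [dotProduct, mulVec, Fin.sum_univ_four]
    ring
  let e : (Fin 4 → F) ≃ₗ[F] (Fin 4 → F) := LinearEquiv.ofBijective P.mulVecLin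
    ⟨mulVec_injective_of_det hPd, fun y => by
      obtain ⟨x, rfl⟩ := exists_mulVec_eq hPd y; exact ⟨x, rfl⟩⟩
  refine ⟨fun t => (stdPlane F t).map (e : (Fin 4 → F) →ₗ[F] (Fin 4 → F)), ?_, ?_, ?_, ?_⟩
  · exact (Submodule.map_injective_of_injective e.injective).comp stdPlane_injective
  · intro t
    rw [LinearEquiv.finrank_map_eq, finrank_stdPlane]
  · rintro t _ ⟨z, hz, rfl⟩
    change (P *ᵥ z) ⬝ᵥ S *ᵥ (P *ᵥ z) = 0
    rw [hform, isotropic_of_mem_stdPlane hz, mul_zero]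
  · intro V hV hiso
    obtain ⟨t, ht⟩ := exists_stdPlane_eq
      (W := V.map (e.symm : (Fin 4 → F) →ₗ[F] (Fin 4 → F)))
      (by rw [LinearEquiv.finrank_map_eq, hV]) (by
        rintro _ ⟨y, hy, rfl⟩
        have h1 : y = P *ᵥ e.symm y := (e.apply_symm_apply y).symm
        have := hiso y hy
        rw [h1, hform] at this
        simpa [h2, hh] using this)
    refine ⟨t, ?_⟩
    beta_reduce
    rw [← ht, ← Submodule.map_comp]
    ext y
    simp

end IsotropicSubspaces

/-! ### Lifting subspaces of `F_p^m` to unimodular matrices. -/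

section Lifting

variable {p : ℕ} [Fact p.Prime] {m : ℕ}

/-- An elementary matrix lifts by lifting its one off-diagonal entry, and its determinant stays one.
-/
theorem exists_lift_transvections (L : List (TransvectionStruct (Fin m) (ZMod p))) :
    ∃ U ∈ intGL m, red p U = (L.map TransvectionStruct.toMatrix).prod := by
  induction L with
  | nil => exact ⟨1, one_mem_intGL, by simp [red]⟩
  | cons t L ih =>
    obtain ⟨U, hU, h⟩ := ih
    obtain ⟨c, hc⟩ := ZMod.intCast_surjective t.c
    let s : TransvectionStruct (Fin m) ℤ := ⟨t.i, t.j, t.hij, c⟩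
    refine ⟨s.toMatrix * U, intGL_mul ?_ hU, ?_⟩
    · refine (Matrix.isUnit_iff_isUnit_det _).2 ?_
      rw [TransvectionStruct.det]; exact isUnit_one
    · rw [red_mul, h, List.map_cons, List.prod_cons]
      congr 1
      ext i j
      simp [red, s, TransvectionStruct.toMatrix, transvection, Matrix.single, Matrix.one_apply,
        ← hc, apply_ite (Int.cast : ℤ → ZMod p)]

theorem range_mulVecLin_mul_of_isUnit {K : Type*} [Field K] (A B : Matrix (Fin m) (Fin m) K)
    (hB : IsUnit B) : LinearMap.range (A * B).mulVecLin = LinearMap.range A.mulVecLin := by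
  rw [mulVecLin_mul, LinearMap.range_comp_of_range_eq_top]
  rw [LinearMap.range_eq_top]
  exact Matrix.mulVec_surjective_iff_isUnit.2 hB

/-- Every subspace of `F_p^m` is spanned by the reductions of the first columns of a unimodular
integral matrix. -/
theorem exists_unimodular_span (W : Submodule (ZMod p) (Fin m → ZMod p)) {k : ℕ}
    (hW : Module.finrank (ZMod p) W = k) : ∃ U ∈ intGL m,
      LinearMap.range (red p U * diagonal fun i : Fin m => if i.val < k then 1 else 0).mulVecLin = W := by
  -- `W` is written as the range of a projection, which transvections reduce to a diagonal matrix.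
  -- The transvections lift to `ℤ`; the diagonal factor affects the range only through its support.
  obtain ⟨W', hW'⟩ := Submodule.exists_isCompl W
  let π := W.projection W' hW'
  let A := LinearMap.toMatrix' π
  have hA : LinearMap.range A.mulVecLin = W := by
    rw [← toLin'_apply', Matrix.toLin'_toMatrix']
    exact Submodule.range_projection hW'
  obtain ⟨L, L', d, hd⟩ := Pivot.exists_list_transvec_mul_diagonal_mul_list_transvec A
  obtain ⟨U, hU, hUL⟩ := exists_lift_transvections L
  obtain ⟨V, hV, hVL⟩ := exists_lift_transvections L'
  have hVu : IsUnit (red p V) := (Matrix.isUnit_iff_isUnit_det _).2 (isUnit_det_red p hV)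
  have hUu := isUnit_det_red p hU
  rw [← hUL, ← hVL] at hd
  have hcard : Fintype.card {i : Fin m // i.val < k} = Fintype.card {i : Fin m // d i ≠ 0} := by
    have h1 : A.rank = k := by rw [Matrix.rank, hA, hW]
    rw [hd, rank_mul_eq_left_of_isUnit_det _ _ (isUnit_det_red p hV),
      rank_mul_eq_right_of_isUnit_det _ _ hUu, rank_diagonal] at h1
    have hk : k ≤ m := by
      rw [← hW]; exact (Submodule.finrank_le W).trans_eq (Module.finrank_fin_fun _)
    rw [h1, Fintype.card_subtype]
    exact Fin.card_filter_val_lt.trans (min_eq_right hk)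
  -- `σ` carries the first `k` indices to those of the nonzero diagonal entries.
  let σ : Equiv.Perm (Fin m) := (Fintype.equivOfCardEq hcard).extendSubtype
  have hσ : ∀ i : Fin m, i.val < k ↔ d (σ i) ≠ 0 := by
    intro i
    constructor
    · intro h
      rw [Equiv.extendSubtype_apply_of_mem _ i h]
      exact (Fintype.equivOfCardEq hcard ⟨i, h⟩).2
    · intro h
      by_contra h'
      exact Equiv.extendSubtype_not_mem (Fintype.equivOfCardEq hcard) i h' h
  refine ⟨U.submatrix (Equiv.refl _) σ, (isUnit_submatrix_equiv _ _).2 hU, ?_⟩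
  rw [← hA, hd, range_mulVecLin_mul_of_isUnit _ _ hVu]
  have h1 : red p (U.submatrix (Equiv.refl _) σ) * diagonal (fun i => if i.val < k then 1 else 0) =
      (red p U * diagonal fun i => if d i ≠ 0 then 1 else 0) *
        (1 : Matrix (Fin m) (Fin m) (ZMod p)).submatrix (Equiv.refl _) σ := by
    have h2 : diagonal (fun i : Fin m => if i.val < k then (1 : ZMod p) else 0) =
        (diagonal fun i => if d i ≠ 0 then (1 : ZMod p) else 0).submatrix σ σ := by
      rw [submatrix_diagonal_equiv]
      congr 1
      ext i
      simp [hσ i]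
    rw [h2, show red p (U.submatrix (Equiv.refl _) σ) = (red p U).submatrix (Equiv.refl _) σ from
      rfl, submatrix_mul_equiv]
    ext i j
    rw [Matrix.mul_apply]
    simp [Matrix.one_apply]
  have h3 : red p U * diagonal d = (red p U * diagonal fun i => if d i ≠ 0 then 1 else 0) *
      diagonal fun i => if d i ≠ 0 then d i else 1 := by
    rw [Matrix.mul_assoc, diagonal_mul_diagonal]
    congr 2
    ext i
    by_cases h : d i = 0 <;> simp [h]
  rw [h1, h3, range_mulVecLin_mul_of_isUnit _ (diagonal fun i => if d i ≠ 0 then d i else 1),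
    range_mulVecLin_mul_of_isUnit _ (submatrix 1 _ _)]
  · exact (isUnit_submatrix_equiv _ _).2 isUnit_one
  · rw [Matrix.isUnit_iff_isUnit_det, det_diagonal, IsUnit.prod_univ_iff]
    intro i
    by_cases h : d i = 0 <;> simp [h]

end Lifting

/-! ### Counting isotropic cosets by column spaces modulo `p`. -/

section ColumnSpace

variable (p : ℕ) {m : ℕ}

theorem red_formMatrix_isSymm (q : IntForm m) : (red p (formMatrix q)).IsSymm := by
  rw [Matrix.IsSymm, ← red_transpose, (formMatrix_isSymm q).eq]

/-- The image in `F_p^m` of the lattice spanned by the columns of an integral matrix. -/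
def colSpace [Fact p.Prime] (M : Matrix (Fin m) (Fin m) ℤ) :
    Submodule (ZMod p) (Fin m → ZMod p) :=
  LinearMap.range (red p M).mulVecLin

variable [Fact p.Prime]

theorem mem_colSpace {M : Matrix (Fin m) (Fin m) ℤ} {y : Fin m → ZMod p} :
    y ∈ colSpace p M ↔ ∃ v : Fin m → ℤ, y = fun i => ((M *ᵥ v) i : ZMod p) := by
  constructor
  · rintro ⟨x, rfl⟩
    choose v hv using fun i => ZMod.intCast_surjective (x i)
    refine ⟨v, ?_⟩
    rw [← red_mulVec, mulVecLin_apply]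
    congr 1
    ext i; exact (hv i).symm
  · rintro ⟨v, rfl⟩
    rw [← red_mulVec]
    exact ⟨_, rfl⟩

theorem colSpace_mul {U : Matrix (Fin m) (Fin m) ℤ} (hU : U ∈ intGL m)
    (M : Matrix (Fin m) (Fin m) ℤ) : colSpace p (M * U) = colSpace p M := by
  rw [colSpace, red_mul, range_mulVecLin_mul_of_isUnit]
  · rfl
  · exact (Matrix.isUnit_iff_isUnit_det _).2 (isUnit_det_red p hU)

/-- The isotropic cosets are counted by the column spaces modulo `p` of their members. -/
theorem isotropicSum_eq_card {q : IntForm m} {d : ℤ} (hd : d ≠ 0) {D : Matrix (Fin m) (Fin m) ℤ}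
    {T : Type*} [Fintype T] {W : T → Submodule (ZMod p) (Fin m → ZMod p)}
    (hW : Function.Injective W)
    (hex : ∀ t, ∃ U ∈ intGL m, (∀ v, d ∣ q ((U * D) *ᵥ v)) ∧ colSpace p (U * D) = W t)
    (hcl : ∀ U ∈ intGL m, (∀ v, d ∣ q ((U * D) *ᵥ v)) → ∃ t, colSpace p (U * D) = W t)
    (hun : ∀ U ∈ intGL m, ∀ V ∈ intGL m, (∀ v, d ∣ q ((U * D) *ᵥ v)) →
      (∀ v, d ∣ q ((V * D) *ᵥ v)) → colSpace p (U * D) = colSpace p (V * D) →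
      coset (U * D) (intGL m) = coset (V * D) (intGL m)) :
    isotropicSum d q D (0 : Matrix (Fin m) (Fin m) ℤ) = Fintype.card T := by
  choose U hU hdiv hcol using hex
  have hinj : Function.Injective fun t => coset (U t * D) (intGL m) := by
    intro s t h
    obtain ⟨X, hX, h⟩ := exists_of_coset_eq h
    apply hW
    rw [← hcol, ← hcol t, h, colSpace_mul p hX]
  have hset : isotropicCosets d q D (0 : Matrix (Fin m) (Fin m) ℤ) =
      (fun t => coset (U t * D) (intGL m)) '' Set.univ := by
    ext c
    constructor
    · rintro ⟨_, ⟨A, hA, B, hB, rfl⟩, hf, -, rfl⟩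
      rw [exists_subst_eq_smul_iff hd] at hf
      have hf' : ∀ v, d ∣ q ((A * D) *ᵥ v) := by
        intro v
        obtain ⟨C, -, hBC, -⟩ := exists_intGL_inv hB
        have := hf (C *ᵥ v)
        rwa [mulVec_mulVec, Matrix.mul_assoc, hBC, Matrix.mul_one] at this
      obtain ⟨t, ht⟩ := hcl A hA hf'
      refine ⟨t, trivial, ?_⟩
      rw [coset_mul_intGL _ hB]
      exact hun _ (hU t) _ hA (hdiv t) hf' ((hcol t).trans ht.symm)
    · rintro ⟨t, -, rfl⟩
      exact ⟨U t * D, ⟨U t, hU t, 1, one_mem_intGL, by simp⟩,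
        (exists_subst_eq_smul_iff hd q _).2 (hdiv t), ⟨0, by simp⟩, rfl⟩
  rw [isotropicSum, hset, hinj.encard_image, Set.encard_univ, ENat.card_eq_coe_fintype_card]

variable {p}

theorem dotProduct_red_formMatrix (q : IntForm m) (x y : Fin m → ℤ) :
    (fun i => (x i : ZMod p)) ⬝ᵥ red p (formMatrix q) *ᵥ (fun i => (y i : ZMod p)) =
      ((x ⬝ᵥ formMatrix q *ᵥ y : ℤ) : ZMod p) := by
  rw [red_mulVec]
  simp [dotProduct]

theorem dvd_form_iff (h2 : (2 : ZMod p) ≠ 0) (q : IntForm m) (x : Fin m → ℤ) :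
    (p : ℤ) ∣ q x ↔
      (fun i => (x i : ZMod p)) ⬝ᵥ red p (formMatrix q) *ᵥ (fun i => (x i : ZMod p)) = 0 := by
  rw [dotProduct_red_formMatrix, ← two_mul_form, ← ZMod.intCast_zmod_eq_zero_iff_dvd]
  push_cast
  simp [h2]

end ColumnSpace

/-! ### The quaternary isotropic sum. -/

section Quaternary

variable {p : ℕ} [Fact p.Prime]

theorem red_diagonal_four : red p (diagonal ![1, 1, (p : ℤ), (p : ℤ)]) =
    diagonal fun i : Fin 4 => if i.val < 2 then 1 else 0 := by
  ext i j; fin_cases i <;> fin_cases j <;> simp [red]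

/-- The lattice of `A diag(1, 1, p, p)` contains `p ℤ⁴`, so membership in it is decided modulo `p`.
-/
theorem mulVec_mem_of_colSpace_le {A B : Matrix (Fin 4) (Fin 4) ℤ} (hA : A ∈ intGL 4)
    (h : colSpace p B ≤ colSpace p (A * diagonal ![1, 1, (p : ℤ), (p : ℤ)])) (v : Fin 4 → ℤ) :
    ∃ w, B *ᵥ v = (A * diagonal ![1, 1, (p : ℤ), (p : ℤ)]) *ᵥ w := by
  obtain ⟨w, hw⟩ := (mem_colSpace p).1 (h ((mem_colSpace p).2 ⟨v, rfl⟩))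
  obtain ⟨C, -, hAC, -⟩ := exists_intGL_inv hA
  have hdvd : ∀ i, (p : ℤ) ∣ (B *ᵥ v - (A * diagonal ![1, 1, (p : ℤ), (p : ℤ)]) *ᵥ w) i := by
    intro i
    rw [← ZMod.intCast_zmod_eq_zero_iff_dvd, Pi.sub_apply, Int.cast_sub, sub_eq_zero]
    exact congrFun hw i
  choose u hu using hdvd
  -- The complementary diagonal exhibits `p ℤ⁴` inside the lattice.
  have hdd : diagonal ![1, 1, (p : ℤ), (p : ℤ)] * diagonal ![(p : ℤ), (p : ℤ), 1, 1] =
      (p : ℤ) • (1 : Matrix (Fin 4) (Fin 4) ℤ) := by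
    ext i j; fin_cases i <;> fin_cases j <;> simp
  refine ⟨w + diagonal ![(p : ℤ), (p : ℤ), 1, 1] *ᵥ (C *ᵥ u), ?_⟩
  rw [mulVec_add, mulVec_mulVec, mulVec_mulVec, Matrix.mul_assoc A, hdd, Matrix.mul_smul,
    Matrix.mul_one, Matrix.smul_mul, hAC, smul_mulVec, one_mulVec]
  ext i
  have := hu i
  simp only [Pi.sub_apply, Pi.add_apply, Pi.smul_apply, smul_eq_mul] at this ⊢
  linarith

theorem isotropicSum_quaternary {n : IntForm 4} (hp2 : p ≠ 2) {δ : ℤ} (hδ : formDet n = δ ^ 2)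
    (hn : ¬ (p : ℤ) ∣ δ) : isotropicSum (p : ℤ) n (diagonal ![1, 1, (p : ℤ), (p : ℤ)])
      (0 : Matrix (Fin 4) (Fin 4) ℤ) = 2 * ((p : ℕ∞) + 1) := by
  have hp : p.Prime := Fact.out
  have h2 : (2 : ZMod p) ≠ 0 := by
    intro h
    have : ((2 : ℕ) : ZMod p) = 0 := by exact_mod_cast h
    rw [ZMod.natCast_eq_zero_iff] at this
    exact hp2 ((Nat.prime_dvd_prime_iff_eq hp Nat.prime_two).1 this)
  obtain ⟨W, hinj, hfin, hiso, hall⟩ := exists_isotropic_planes h2 (red_formMatrix_isSymm p n)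
    (δ := (δ : ZMod p)) (by rw [det_red, ← formDet, hδ]; push_cast; rfl)
    (by rwa [Ne, ZMod.intCast_zmod_eq_zero_iff_dvd])
  rw [isotropicSum_eq_card p (by exact_mod_cast hp.ne_zero) hinj]
  · simp [two_mul]
  · intro t
    obtain ⟨U, hU, h⟩ := exists_unimodular_span (W t) (hfin t)
    have hcol : colSpace p (U * diagonal ![1, 1, (p : ℤ), (p : ℤ)]) = W t := by
      rw [colSpace, red_mul, red_diagonal_four, h]
    refine ⟨U, hU, fun v => ?_, hcol⟩
    rw [dvd_form_iff h2]
    exact hiso t _ (hcol ▸ (mem_colSpace p).2 ⟨v, rfl⟩)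
  · intro U hU h
    refine hall _ ?_ ?_
    · have : (diagonal ![1, 1, (p : ℤ), (p : ℤ)]) =
          diagonal fun i : Fin 4 => (p : ℤ) ^ (![0, 0, 1, 1] i) := by
        congr 1; ext i; fin_cases i <;> simp
      change (red p _).rank = 2
      rw [this, ← Matrix.mul_one (U * _), rank_red_smith p hU one_mem_intGL]
      decide
    · intro y hy
      obtain ⟨v, rfl⟩ := (mem_colSpace p).1 hy
      exact (dvd_form_iff h2 _ _).1 (h v)
  · intro U hU V hV _ _ h
    apply coset_eq_of_range_le
    · rw [det_mul, det_diagonal]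
      refine mul_ne_zero (fun h0 => ?_) ?_
      · have := det_sq_of_mem_intGL hU
        simp [h0] at this
      · simp [Fin.prod_univ_four, hp.ne_zero]
    · exact mulVec_mem_of_colSpace_le hV h.le
    · exact mulVec_mem_of_colSpace_le hU h.ge

end Quaternary

/-! ### The ternary isotropic sum. -/

section Ternary

theorem formMatrix_self {m : ℕ} (q : IntForm m) (i : Fin m) :
    formMatrix q i i = 2 * q (Pi.single i 1) := by
  rw [formMatrix_apply, QuadraticMap.polar_self, two_nsmul, two_mul]

theorem formMatrix_comm {m : ℕ} (q : IntForm m) (i j : Fin m) :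
    formMatrix q i j = formMatrix q j i := (formMatrix_isSymm q).apply j i

theorem form_three_apply (q : IntForm 3) (z : Fin 3 → ℤ) :
    q z = q (Pi.single 0 1) * z 0 ^ 2 + q (Pi.single 1 1) * z 1 ^ 2 + q (Pi.single 2 1) * z 2 ^ 2 +
      formMatrix q 0 1 * (z 0 * z 1) + formMatrix q 0 2 * (z 0 * z 2) +
      formMatrix q 1 2 * (z 1 * z 2) := by
  have h := two_mul_form q z
  simp only [dotProduct, mulVec, Fin.sum_univ_three, formMatrix_self, formMatrix_comm q 1 0,
    formMatrix_comm q 2 0, formMatrix_comm q 2 1] at h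
  linarith

variable {p : ℕ}

theorem not_dvd_row {f : IntForm 3} (hf : ¬ (p : ℤ) ∣ formDet f)
    (h0 : (p : ℤ) ∣ f (Pi.single 0 1)) (h1 : (p : ℤ) ∣ formMatrix f 0 1) :
    ¬ (p : ℤ) ∣ formMatrix f 0 2 := by
  intro h2
  apply hf
  rw [formDet, det_fin_three, formMatrix_self f 0]
  obtain ⟨a, ha⟩ := h0
  obtain ⟨b, hb⟩ := h1
  obtain ⟨c, hc⟩ := h2
  rw [ha, hb, hc]
  refine ⟨2 * a * formMatrix f 1 1 * formMatrix f 2 2 - 2 * a * formMatrix f 1 2 * formMatrix f 2 1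
    - b * formMatrix f 1 0 * formMatrix f 2 2 + b * formMatrix f 1 2 * formMatrix f 2 0
    + c * formMatrix f 1 0 * formMatrix f 2 1 - c * formMatrix f 1 1 * formMatrix f 2 0, ?_⟩
  ring

variable [Fact p.Prime]

theorem red_diagonal_three : red p (diagonal ![1, (p : ℤ), (p : ℤ) ^ 2]) =
    diagonal fun i : Fin 3 => if i.val < 1 then 1 else 0 := by
  ext i j; fin_cases i <;> fin_cases j <;> simp [red]

theorem diagonal_three_mulVec (a b c : ℤ) (v : Fin 3 → ℤ) :
    diagonal ![a, b, c] *ᵥ v = ![a * v 0, b * v 1, c * v 2] := by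
  ext i; fin_cases i <;> simp [mulVec_diagonal]

/-- An isotropic lattice of type `(1, p, p²)` consists of the vectors which modulo `p` lie on its
line and which modulo `p²` are orthogonal to a primitive vector on it. -/
theorem exists_mulVec_of_mem_colSpace {q : IntForm 3} (hq : ¬ (p : ℤ) ∣ formDet q)
    {U : Matrix (Fin 3) (Fin 3) ℤ} (hU : U ∈ intGL 3)
    (h : ∀ v, (p : ℤ) ^ 2 ∣ q ((U * diagonal ![1, (p : ℤ), (p : ℤ) ^ 2]) *ᵥ v)) {v : Fin 3 → ℤ}
    (hv : (fun i => (v i : ZMod p)) ∈ colSpace p (U * diagonal ![1, (p : ℤ), (p : ℤ) ^ 2]))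
    (hB : (p : ℤ) ^ 2 ∣ v ⬝ᵥ formMatrix q *ᵥ (U *ᵥ Pi.single 0 1)) :
    ∃ w, v = (U * diagonal ![1, (p : ℤ), (p : ℤ) ^ 2]) *ᵥ w := by
  have hp : (p : ℤ) ≠ 0 := by exact_mod_cast (Fact.out : p.Prime).ne_zero
  have hpp : Prime (p : ℤ) := Nat.prime_iff_prime_int.1 Fact.out
  obtain ⟨C, -, hUC, hCU⟩ := exists_intGL_inv hU
  obtain ⟨z, rfl⟩ : ∃ z, v = U *ᵥ z := ⟨C *ᵥ v, by rw [mulVec_mulVec, hUC, one_mulVec]⟩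
  obtain ⟨s, hs⟩ := (mem_colSpace p).1 hv
  have hdvd : ∀ i, (p : ℤ) ∣ (z - diagonal ![1, (p : ℤ), (p : ℤ) ^ 2] *ᵥ s) i := by
    intro i
    have h1 : z - diagonal ![1, (p : ℤ), (p : ℤ) ^ 2] *ᵥ s =
        C *ᵥ (U *ᵥ z - (U * diagonal ![1, (p : ℤ), (p : ℤ) ^ 2]) *ᵥ s) := by
      rw [← mulVec_mulVec, ← mulVec_sub, mulVec_mulVec, hCU, one_mulVec]
    rw [h1, mulVec, dotProduct]
    refine Finset.dvd_sum fun j _ => dvd_mul_of_dvd_right ?_ _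
    rw [← ZMod.intCast_zmod_eq_zero_iff_dvd, Pi.sub_apply, Int.cast_sub, sub_eq_zero]
    exact congrFun hs j
  rw [diagonal_three_mulVec] at hdvd
  obtain ⟨a, ha⟩ : (p : ℤ) ∣ z 1 := by
    have := dvd_add (hdvd 1) (Dvd.intro (s 1) rfl)
    simpa using this
  obtain ⟨b, hb⟩ : (p : ℤ) ∣ z 2 := by
    have := dvd_add (hdvd 2) (Dvd.intro ((p : ℤ) * s 2) rfl)
    simpa [pow_two, mul_assoc] using this
  set f := subst q U with hf
  have hfdet : ¬ (p : ℤ) ∣ formDet f := by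
    rwa [hf, formDet_subst, det_sq_of_mem_intGL hU, one_mul]
  have hfD : ∀ v, (p : ℤ) ^ 2 ∣ f (diagonal ![1, (p : ℤ), (p : ℤ) ^ 2] *ᵥ v) := fun v => by
    rw [hf, subst_apply, mulVec_mulVec]; exact h v
  have h00 : (p : ℤ) ^ 2 ∣ f (Pi.single 0 1) := by
    have := hfD (Pi.single 0 1)
    rwa [diagonal_three_mulVec, show (![1 * (Pi.single 0 1 : Fin 3 → ℤ) 0,
      p * (Pi.single 0 1 : Fin 3 → ℤ) 1, (p : ℤ) ^ 2 * (Pi.single 0 1 : Fin 3 → ℤ) 2] :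
      Fin 3 → ℤ) = Pi.single 0 1 by ext i; fin_cases i <;> simp] at this
  have h01 : (p : ℤ) ∣ formMatrix f 0 1 := by
    have := dvd_formMatrix_subst_of_dvd hfD (Pi.single 0 1) (Pi.single 1 1)
    rw [diagonal_three_mulVec, diagonal_three_mulVec] at this
    simp [dotProduct, mulVec, Fin.sum_univ_three, pow_two] at this
    exact (mul_dvd_mul_iff_right hp).1 this
  -- In the basis given by `U`, the first Gram row is `(0, 0, unit)` modulo `p`. Given `p ∣ z 1` and
  -- `p ∣ z 2`, orthogonality modulo `p²` therefore forces `p² ∣ z 2`.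
  have h02 := not_dvd_row hfdet ((dvd_pow_self _ two_ne_zero).trans h00) h01
  have hB' : (U *ᵥ z) ⬝ᵥ formMatrix q *ᵥ (U *ᵥ Pi.single 0 1) =
      z 0 * (2 * f (Pi.single 0 1)) + z 1 * formMatrix f 0 1 + z 2 * formMatrix f 0 2 := by
    have : (U *ᵥ z) ⬝ᵥ formMatrix q *ᵥ (U *ᵥ Pi.single 0 1) =
        z ⬝ᵥ formMatrix f *ᵥ Pi.single 0 1 := by
      rw [hf, formMatrix_subst, ← mulVec_mulVec, ← mulVec_mulVec, dotProduct_mulVec z,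
        vecMul_transpose]
    rw [this, mulVec_single_one]
    simp only [dotProduct, Fin.sum_univ_three, col_apply, formMatrix_self, formMatrix_comm f 1 0,
      formMatrix_comm f 2 0]
  rw [hB'] at hB
  obtain ⟨c, hc⟩ : (p : ℤ) ∣ b := by
    have h3 : (p : ℤ) ^ 2 ∣ z 2 * formMatrix f 0 2 := by
      have h4 : (p : ℤ) ^ 2 ∣ z 0 * (2 * f (Pi.single 0 1)) + z 1 * formMatrix f 0 1 :=
        dvd_add ((h00.mul_left _).mul_left _) (by
          rw [ha, pow_two]
          exact mul_dvd_mul (Dvd.intro _ rfl) h01)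
      exact (dvd_add_right h4).1 hB
    rw [hb, pow_two, mul_assoc, mul_dvd_mul_iff_left hp] at h3
    exact (hpp.dvd_or_dvd h3).resolve_right h02
  refine ⟨![z 0, a, c], ?_⟩
  rw [← mulVec_mulVec, diagonal_three_mulVec]
  congr 1
  ext i; fin_cases i
  · simp
  · simpa using ha
  · simp [hb, hc]; ring

theorem colSpace_three (U : Matrix (Fin 3) (Fin 3) ℤ) :
    colSpace p (U * diagonal ![1, (p : ℤ), (p : ℤ) ^ 2]) =
      Submodule.span (ZMod p) {fun i => ((U *ᵥ Pi.single 0 1) i : ZMod p)} := by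
  ext y
  rw [mem_colSpace, Submodule.mem_span_singleton]
  have key : ∀ v : Fin 3 → ℤ, (fun i =>
      (((U * diagonal ![1, (p : ℤ), (p : ℤ) ^ 2]) *ᵥ v) i : ZMod p)) =
      (v 0 : ZMod p) • fun i => ((U *ᵥ Pi.single 0 1) i : ZMod p) := by
    intro v
    rw [← mulVec_mulVec, diagonal_three_mulVec]
    ext i
    simp [mulVec, dotProduct, Fin.sum_univ_three]
    ring
  constructor
  · rintro ⟨v, rfl⟩
    exact ⟨_, (key v).symm⟩
  · rintro ⟨c, rfl⟩
    obtain ⟨c, rfl⟩ := ZMod.intCast_surjective c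
    exact ⟨![c, 0, 0], by rw [key]; rfl⟩

theorem first_col_ne_zero {U : Matrix (Fin 3) (Fin 3) ℤ} (hU : U ∈ intGL 3) :
    (fun i => ((U *ᵥ Pi.single 0 1) i : ZMod p)) ≠ 0 := by
  rw [← red_mulVec]
  intro h
  have := Matrix.eq_zero_of_mulVec_eq_zero (isUnit_det_red p hU).ne_zero h
  simpa using congrFun this 0

/-- Uniqueness of the lift of a line. The first column of `V` already lies in the lattice of `U`,
where all products are divisible by `p²`. Every vector of that lattice thus meets the orthogonality
condition defining the lattice of `V`. -/
theorem mulVec_mem_of_colSpace_eq {q : IntForm 3} (hq : ¬ (p : ℤ) ∣ formDet q)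
    {U V : Matrix (Fin 3) (Fin 3) ℤ} (hU : U ∈ intGL 3) (hV : V ∈ intGL 3)
    (h : ∀ v, (p : ℤ) ^ 2 ∣ q ((U * diagonal ![1, (p : ℤ), (p : ℤ) ^ 2]) *ᵥ v))
    (h' : ∀ v, (p : ℤ) ^ 2 ∣ q ((V * diagonal ![1, (p : ℤ), (p : ℤ) ^ 2]) *ᵥ v))
    (hUV : colSpace p (U * diagonal ![1, (p : ℤ), (p : ℤ) ^ 2]) =
      colSpace p (V * diagonal ![1, (p : ℤ), (p : ℤ) ^ 2])) (v : Fin 3 → ℤ) :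
    ∃ w, (U * diagonal ![1, (p : ℤ), (p : ℤ) ^ 2]) *ᵥ v =
      (V * diagonal ![1, (p : ℤ), (p : ℤ) ^ 2]) *ᵥ w := by
  have hp : (p : ℤ) ≠ 0 := by exact_mod_cast (Fact.out : p.Prime).ne_zero
  have hpp : Prime (p : ℤ) := Nat.prime_iff_prime_int.1 Fact.out
  have hfirst : ∀ A : Matrix (Fin 3) (Fin 3) ℤ, A *ᵥ Pi.single 0 1 =
      (A * diagonal ![1, (p : ℤ), (p : ℤ) ^ 2]) *ᵥ Pi.single 0 1 := by
    intro A
    rw [← mulVec_mulVec, diagonal_three_mulVec]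
    congr 1
    ext i; fin_cases i <;> simp
  have hx : (p : ℤ) ^ 2 ∣ q (U *ᵥ Pi.single 0 1) := by rw [hfirst]; exact h _
  have hy : (p : ℤ) ^ 2 ∣ q (V *ᵥ Pi.single 0 1) := by rw [hfirst]; exact h' _
  have hxU : (fun i => ((V *ᵥ Pi.single 0 1) i : ZMod p)) ∈
      colSpace p (U * diagonal ![1, (p : ℤ), (p : ℤ) ^ 2]) := by
    rw [hUV, colSpace_three]; exact Submodule.mem_span_singleton_self _
  obtain ⟨w₀, hw₀⟩ : ∃ w, V *ᵥ Pi.single 0 1 =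
      (U * diagonal ![1, (p : ℤ), (p : ℤ) ^ 2]) *ᵥ w := by
    refine exists_mulVec_of_mem_colSpace hq hU h hxU ?_
    obtain ⟨c, hc⟩ := Submodule.mem_span_singleton.1 (colSpace_three (p := p) U ▸ hxU)
    obtain ⟨c, rfl⟩ := ZMod.intCast_surjective c
    have hcp : ¬ (p : ℤ) ∣ c := by
      rw [← ZMod.intCast_zmod_eq_zero_iff_dvd]
      intro h0
      rw [h0, zero_smul] at hc
      exact first_col_ne_zero hV hc.symm
    have hdvd : ∀ i, (p : ℤ) ∣ (V *ᵥ Pi.single 0 1 - c • U *ᵥ Pi.single 0 1) i := by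
      intro i
      rw [← ZMod.intCast_zmod_eq_zero_iff_dvd, Pi.sub_apply, Int.cast_sub, sub_eq_zero]
      simpa using (congrFun hc i).symm
    choose u hu using hdvd
    -- With `y = c x + p u`, comparing `q y` and `q x` modulo `p²` gives `p ∣ c B(u, x)`, hence `p ∣
    -- B(u, x)` and `p² ∣ B(y, x)`.
    have hVU : V *ᵥ Pi.single 0 1 = c • U *ᵥ Pi.single 0 1 + (p : ℤ) • u := by
      ext i
      have := hu i
      simp only [Pi.sub_apply, Pi.add_apply, Pi.smul_apply, smul_eq_mul] at this ⊢
      linarith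
    set x := U *ᵥ Pi.single 0 1
    have hsymm : x ⬝ᵥ formMatrix q *ᵥ u = u ⬝ᵥ formMatrix q *ᵥ x := by
      rw [← polar_eq_dotProduct, ← polar_eq_dotProduct, QuadraticMap.polar_comm]
    rw [hVU, form_add, QuadraticMap.map_smul, QuadraticMap.map_smul, mulVec_smul, smul_dotProduct,
      dotProduct_smul, hsymm] at hy
    simp only [smul_eq_mul] at hy
    have h1 : (p : ℤ) ^ 2 ∣ p * (c * u ⬝ᵥ formMatrix q *ᵥ x) := by
      have h2 : (p : ℤ) ^ 2 ∣ c * c * q x + p * p * q u :=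
        dvd_add (hx.mul_left _) (by rw [pow_two]; exact Dvd.intro _ rfl)
      have := (dvd_add_right h2).1 hy
      rwa [mul_left_comm] at this
    rw [pow_two, mul_dvd_mul_iff_left hp] at h1
    have h3 := (hpp.dvd_or_dvd h1).resolve_left hcp
    rw [hVU, add_dotProduct, smul_dotProduct, smul_dotProduct, ← two_mul_form, smul_eq_mul,
      smul_eq_mul]
    refine dvd_add ((hx.mul_left _).mul_left _) ?_
    rw [pow_two]
    exact mul_dvd_mul_left _ h3
  refine exists_mulVec_of_mem_colSpace hq hV h' ?_ ?_
  · rw [← hUV]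
    exact (mem_colSpace p).2 ⟨v, rfl⟩
  · rw [hw₀]
    exact dvd_formMatrix_subst_of_dvd h v w₀

/-- Whichever of `g₁`, `g₂` is invertible modulo `p` solves both congruences. The pair `(a, b)` is
chosen with an entry one, so it completes to a unimodular matrix. -/
theorem exists_isotropic_adjustment {r g₁ g₂ : ℤ} (h : (p : ℤ) ∣ g₁ → ¬ (p : ℤ) ∣ g₂) :
    ∃ t₁ t₂ a b c d : ℤ, (p : ℤ) ∣ r + t₁ * g₁ + t₂ * g₂ ∧ (p : ℤ) ∣ a * g₁ + b * g₂ ∧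
      IsUnit (a * d - b * c) := by
  have hinv : ∀ g : ℤ, ¬ (p : ℤ) ∣ g → ∃ i k : ℤ, i * g = 1 + p * k := by
    intro g hg
    have hpp : Prime (p : ℤ) := Nat.prime_iff_prime_int.1 Fact.out
    obtain ⟨x, y, hxy⟩ := ((Prime.coprime_iff_not_dvd hpp).2 hg)
    exact ⟨y, -x, by linear_combination hxy⟩
  by_cases h1 : (p : ℤ) ∣ g₁
  · obtain ⟨i, k, hi⟩ := hinv g₂ (h h1)
    refine ⟨0, -r * i, 1, 0, 0, 1, ⟨-r * k, by linear_combination -r * hi⟩, by simpa using h1,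
      by norm_num⟩
  · obtain ⟨i, k, hi⟩ := hinv g₁ h1
    refine ⟨-r * i, 0, -i * g₂, 1, 1, 0, ⟨-r * k, by linear_combination -r * hi⟩,
      ⟨-g₂ * k, by linear_combination -g₂ * hi⟩, by norm_num⟩

/-- A Hensel step: moving the first vector by `p t` makes its value divisible by `p²`, since its
pairing with the other basis vectors is not zero modulo `p`. The second column only needs to be
orthogonal to it modulo `p`, and the third, scaled by `p²`, is unconstrained. -/
theorem exists_isotropic_three {f : IntForm 3} (hf : ¬ (p : ℤ) ∣ formDet f)
    (h0 : (p : ℤ) ∣ f (Pi.single 0 1)) : ∃ T ∈ intGL 3,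
      (∀ v, (p : ℤ) ^ 2 ∣ f ((T * diagonal ![1, (p : ℤ), (p : ℤ) ^ 2]) *ᵥ v)) ∧
      ∃ t : Fin 3 → ℤ, T *ᵥ Pi.single 0 1 = Pi.single 0 1 + (p : ℤ) • t := by
  obtain ⟨r, hr⟩ := h0
  obtain ⟨t₁, t₂, a, b, c, d, ⟨k, hk⟩, ⟨l, hl⟩, hu⟩ :=
    exists_isotropic_adjustment (p := p) (r := r) (not_dvd_row hf ⟨r, hr⟩)
  set T : Matrix (Fin 3) (Fin 3) ℤ := !![1, 0, 0; p * t₁, a, c; p * t₂, b, d] with hT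
  have hT0 : T *ᵥ Pi.single 0 1 = ![1, p * t₁, p * t₂] := by
    ext i; fin_cases i <;> simp [hT]
  refine ⟨T, (Matrix.isUnit_iff_isUnit_det _).2 ?_, fun v => ?_, ![0, t₁, t₂], ?_⟩
  · have : T.det = a * d - b * c := by
      rw [hT, det_fin_three]; simp; ring
    rwa [this]
  · rw [← mulVec_mulVec, ← subst_apply, diagonal_three_mulVec, form_three_apply]
    have h00 : (p : ℤ) ^ 2 ∣ subst f T (Pi.single 0 1) := by
      rw [subst_apply, hT0, form_three_apply, hr]
      simp
      refine ⟨k + f (Pi.single 1 1) * t₁ ^ 2 + f (Pi.single 2 1) * t₂ ^ 2 +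
        formMatrix f 1 2 * (t₁ * t₂), ?_⟩
      linear_combination (p : ℤ) * hk
    have h01 : (p : ℤ) ∣ formMatrix (subst f T) 0 1 := by
      rw [formMatrix_subst]
      simp [hT, Matrix.mul_apply, Fin.sum_univ_three]
      refine ⟨l + t₁ * (a * formMatrix f 1 1 + b * formMatrix f 1 2) +
        t₂ * (a * formMatrix f 2 1 + b * formMatrix f 2 2), ?_⟩
      rw [formMatrix_comm f 2 1]
      linear_combination hl
    simp only [cons_val]
    obtain ⟨A, hA⟩ := h00
    obtain ⟨B, hB⟩ := h01
    rw [hA, hB]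
    refine ⟨A * v 0 ^ 2 + subst f T (Pi.single 1 1) * v 1 ^ 2 +
      subst f T (Pi.single 2 1) * p ^ 2 * v 2 ^ 2 + B * (v 0 * v 1) +
      formMatrix (subst f T) 0 2 * (v 0 * v 2) +
      formMatrix (subst f T) 1 2 * (p * v 1 * v 2), ?_⟩
    ring
  · rw [hT0]; ext i; fin_cases i <;> simp

theorem isotropicSum_ternary {q : IntForm 3} (hp2 : p ≠ 2) (hq : ¬ (p : ℤ) ∣ formDet q) :
    isotropicSum ((p : ℤ) ^ 2) q (diagonal ![1, (p : ℤ), (p : ℤ) ^ 2])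
      (0 : Matrix (Fin 3) (Fin 3) ℤ) = (p : ℕ∞) + 1 := by
  have hp : p.Prime := Fact.out
  have h2 : (2 : ZMod p) ≠ 0 := by
    intro h
    have : ((2 : ℕ) : ZMod p) = 0 := by exact_mod_cast h
    rw [ZMod.natCast_eq_zero_iff] at this
    exact hp2 ((Nat.prime_dvd_prime_iff_eq hp Nat.prime_two).1 this)
  obtain ⟨x, hx0, hxiso, hall, hinj⟩ := exists_isotropic_lines h2 (red_formMatrix_isSymm p q)
    (by rwa [det_red, Ne, ZMod.intCast_zmod_eq_zero_iff_dvd])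
  rw [isotropicSum_eq_card p (pow_ne_zero 2 (by exact_mod_cast hp.ne_zero)) hinj]
  · simp
  · intro t
    obtain ⟨U, hU, h⟩ := exists_unimodular_span (Submodule.span (ZMod p) {x t})
      (finrank_span_singleton (hx0 t))
    have hcol : colSpace p (U * diagonal ![1, (p : ℤ), (p : ℤ) ^ 2]) =
        Submodule.span (ZMod p) {x t} := by
      rw [colSpace, red_mul, red_diagonal_three, h]
    have hfdet : ¬ (p : ℤ) ∣ formDet (subst q U) := by
      rwa [formDet_subst, det_sq_of_mem_intGL hU, one_mul]
    obtain ⟨T, hT, hdiv, s, hs⟩ := exists_isotropic_three hfdet (by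
      rw [subst_apply, dvd_form_iff h2]
      have : (fun i => ((U *ᵥ Pi.single 0 1) i : ZMod p)) ∈ Submodule.span (ZMod p) {x t} := by
        rw [← hcol, colSpace_three]; exact Submodule.mem_span_singleton_self _
      obtain ⟨c, hc⟩ := Submodule.mem_span_singleton.1 this
      rw [← hc, mulVec_smul, smul_dotProduct, dotProduct_smul, hxiso, smul_zero, smul_zero])
    refine ⟨U * T, intGL_mul hU hT, fun v => ?_, ?_⟩
    · have := hdiv v
      rwa [subst_apply, mulVec_mulVec, ← Matrix.mul_assoc] at this
    · rw [← hcol, colSpace_three, colSpace_three, ← mulVec_mulVec, hs]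
      congr 2
      rw [mulVec_add, mulVec_smul]
      ext i
      simp
  · intro U hU h
    obtain ⟨t, c, hc⟩ := hall (fun i => ((U *ᵥ Pi.single 0 1) i : ZMod p)) (by
      rw [← dvd_form_iff h2]
      have := h (Pi.single 0 1)
      rw [← mulVec_mulVec, diagonal_three_mulVec] at this
      have he : (![1 * (Pi.single 0 1 : Fin 3 → ℤ) 0,
        p * (Pi.single 0 1 : Fin 3 → ℤ) 1, (p : ℤ) ^ 2 * (Pi.single 0 1 : Fin 3 → ℤ) 2] :
        Fin 3 → ℤ) = Pi.single 0 1 := by ext i; fin_cases i <;> simp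
      rw [he] at this
      exact (dvd_pow_self _ two_ne_zero).trans this)
    refine ⟨t, ?_⟩
    have hc0 : c ≠ 0 := by
      rintro rfl
      exact first_col_ne_zero hU (hc.trans (zero_smul _ _))
    rw [colSpace_three, hc]
    exact Submodule.span_singleton_smul_eq (isUnit_iff_ne_zero.2 hc0) _
  · intro U hU V hV h h' hUV
    apply coset_eq_of_range_le
    · rw [det_mul, det_diagonal]
      refine mul_ne_zero (fun h0 => ?_) ?_
      · have := det_sq_of_mem_intGL hU
        simp [h0] at this
      · simp [Fin.prod_univ_three, hp.ne_zero]
    · exact mulVec_mem_of_colSpace_eq hq hU hV h h' hUV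
    · exact mulVec_mem_of_colSpace_eq hq hV hU h' h hUV.symm

end Ternary

/-! ### The regular representation of the even Clifford algebra. -/

section EvenClifford

/-- Left multiplication by `x y` on the even Clifford algebra of the ternary form with coefficients
`a, b, c` (squares) and `u, v, w` (products `yz`, `xz`, `xy`), in the basis
`1, e₀e₁, e₀e₂, e₁e₂`. -/
def evenMul (a b c u v w : ℤ) (x y : Fin 3 → ℤ) : Matrix (Fin 4) (Fin 4) ℤ :=
  (a * (x 0 * y 0) + b * (x 1 * y 1) + c * (x 2 * y 2) + w * (x 1 * y 0) + v * (x 2 * y 0) +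
      u * (x 2 * y 1)) • (1 : Matrix (Fin 4) (Fin 4) ℤ) +
    (x 0 * y 1 - x 1 * y 0) • !![0, -a * b, 0, 0; 1, w, 0, 0; 0, 0, w, b; 0, 0, -a, 0] +
    (x 0 * y 2 - x 2 * y 0) • !![0, -a * u, -a * c, 0; 0, v, 0, -c; 1, 0, v, u; 0, a, 0, 0] +
    (x 1 * y 2 - x 2 * y 1) • !![0, v * b - w * u, -c * w, -b * c; 0, u, c, 0; 0, -b, 0, 0;
      1, w, v, u]

theorem evenMul_eq (a b c u v w : ℤ) (x y : Fin 3 → ℤ) : ∃ s k l n : ℤ,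
    s = a * (x 0 * y 0) + b * (x 1 * y 1) + c * (x 2 * y 2) + w * (x 1 * y 0) + v * (x 2 * y 0) +
      u * (x 2 * y 1) ∧ k = x 0 * y 1 - x 1 * y 0 ∧ l = x 0 * y 2 - x 2 * y 0 ∧
      n = x 1 * y 2 - x 2 * y 1 ∧
      evenMul a b c u v w x y = !![s, -a * b * k - a * u * l + (v * b - w * u) * n,
        -a * c * l - c * w * n, -b * c * n;
        k, s + w * k + v * l + u * n, c * n, -c * l;
        l, -b * n, s + w * k + v * l, b * k + u * l;
        n, a * l + w * n, -a * k + v * n, s + u * n] := by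
  refine ⟨_, _, _, _, rfl, rfl, rfl, rfl, ?_⟩
  ext i j
  simp only [evenMul, Matrix.add_apply, Matrix.smul_apply, smul_eq_mul]
  fin_cases i <;> fin_cases j <;> simp <;> ring

set_option maxHeartbeats 2000000 in
-- The relation `(x y)(y z) = q(y) x z`, required by the universal property of the even algebra.
theorem evenMul_mul (a b c u v w : ℤ) (x y z : Fin 3 → ℤ) :
    evenMul a b c u v w x y * evenMul a b c u v w y z =
      (a * y 0 ^ 2 + b * y 1 ^ 2 + c * y 2 ^ 2 + w * (y 0 * y 1) + v * (y 0 * y 2) +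
        u * (y 1 * y 2)) • evenMul a b c u v w x z := by
  obtain ⟨s₁, k₁, l₁, n₁, hs₁, hk₁, hl₁, hn₁, h₁⟩ := evenMul_eq a b c u v w x y
  obtain ⟨s₂, k₂, l₂, n₂, hs₂, hk₂, hl₂, hn₂, h₂⟩ := evenMul_eq a b c u v w y z
  obtain ⟨s₃, k₃, l₃, n₃, hs₃, hk₃, hl₃, hn₃, h₃⟩ := evenMul_eq a b c u v w x z
  rw [h₁, h₂, h₃]
  ext i j
  fin_cases i <;> fin_cases j <;> simp [Matrix.mul_apply, Fin.sum_univ_four] <;>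
    (subst hs₁ hk₁ hl₁ hn₁ hs₂ hk₂ hl₂ hn₂ hs₃ hk₃ hl₃ hn₃; ring)

def evenMulBilin (a b c u v w : ℤ) :
    (Fin 3 → ℤ) →ₗ[ℤ] (Fin 3 → ℤ) →ₗ[ℤ] Matrix (Fin 4) (Fin 4) ℤ :=
  LinearMap.mk₂ ℤ (evenMul a b c u v w)
    (fun x x' y => by simp only [evenMul, Pi.add_apply]; module)
    (fun r x y => by simp only [evenMul, Pi.smul_apply, smul_eq_mul]; module)
    (fun x y y' => by simp only [evenMul, Pi.add_apply]; module)
    (fun r x y => by simp only [evenMul, Pi.smul_apply, smul_eq_mul]; module)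

/-- Extends to an algebra map into matrices; it serves to prove linear independence and that `ℤ`
embeds in the Clifford algebra. -/
def evenHom (q : IntForm 3) : CliffordAlgebra.EvenHom q (Matrix (Fin 4) (Fin 4) ℤ) where
  bilin := evenMulBilin (q (Pi.single 0 1)) (q (Pi.single 1 1)) (q (Pi.single 2 1))
    (formMatrix q 1 2) (formMatrix q 0 2) (formMatrix q 0 1)
  contract x := by
    rw [form_three_apply q x, Algebra.algebraMap_eq_smul_one, evenMulBilin, LinearMap.mk₂_apply,
      evenMul]
    module
  contract_mid x y z := by
    rw [form_three_apply q y]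
    exact evenMul_mul _ _ _ _ _ _ x y z

end EvenClifford

/-! ### A basis of the even Clifford algebra and its norm form. -/

section NormForm

/-- The products of `XY`, `XZ`, `YZ` in a ring generated by elements with integral squares and
anticommutators. -/
theorem mul_relations {A : Type*} [Ring A] {X Y Z : A} {a b c u v w : ℤ}
    (hX : X * X = a • (1 : A)) (hY : Y * Y = b • (1 : A)) (hZ : Z * Z = c • (1 : A))
    (hYX : Y * X = w • (1 : A) - X * Y) (hZX : Z * X = v • (1 : A) - X * Z)
    (hZY : Z * Y = u • (1 : A) - Y * Z) :
    (X * Y * (X * Y) = w • (X * Y) - (a * b) • (1 : A) ∧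
      X * Y * (X * Z) = w • (X * Z) - a • (Y * Z) ∧ X * Y * (Y * Z) = b • (X * Z)) ∧
    (X * Z * (X * Y) = v • (X * Y) - (a * u) • (1 : A) + a • (Y * Z) ∧
      X * Z * (X * Z) = v • (X * Z) - (a * c) • (1 : A) ∧
      X * Z * (Y * Z) = u • (X * Z) - c • (X * Y)) ∧
    (Y * Z * (X * Y) = (v * b - w * u) • (1 : A) + w • (Y * Z) + u • (X * Y) - b • (X * Z) ∧
      Y * Z * (X * Z) = v • (Y * Z) - (c * w) • (1 : A) + c • (X * Y) ∧
      Y * Z * (Y * Z) = u • (Y * Z) - (b * c) • (1 : A)) ∧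
    ∀ t k l n : ℤ, (t • (1 : A) + k • (X * Y) + l • (X * Z) + n • (Y * Z)) *
      (t • (1 : A) + k • (Y * X) + l • (Z * X) + n • (Z * Y)) =
      (t * t + w * t * k + v * t * l + u * t * n + a * b * k * k + a * c * l * l + b * c * n * n +
        u * a * k * l + (u * w - b * v) * k * n + c * w * l * n) • (1 : A) := by
  have r1 : ∀ T : A, X * (X * T) = a • T := fun T => by rw [← mul_assoc, hX, smul_one_mul]
  have r2 : ∀ T : A, Y * (Y * T) = b • T := fun T => by rw [← mul_assoc, hY, smul_one_mul]
  have r4 : ∀ T : A, Y * (X * T) = w • T - X * (Y * T) := fun T => by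
    rw [← mul_assoc, hYX, sub_mul, smul_one_mul, mul_assoc]
  have r5 : ∀ T : A, Z * (X * T) = v • T - X * (Z * T) := fun T => by
    rw [← mul_assoc, hZX, sub_mul, smul_one_mul, mul_assoc]
  have r6 : ∀ T : A, Z * (Y * T) = u • T - Y * (Z * T) := fun T => by
    rw [← mul_assoc, hZY, sub_mul, smul_one_mul, mul_assoc]
  refine ⟨⟨?_, ?_, ?_⟩, ⟨?_, ?_, ?_⟩, ⟨?_, ?_, ?_⟩, fun t k l n => ?_⟩ <;>
    simp only [mul_assoc, hX, hY, hZ, hYX, hZX, hZY, r1, r2, r4, r5, r6, mul_sub, sub_mul,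
      mul_add, add_mul, mul_smul_comm, smul_mul_assoc, mul_one, one_mul, smul_sub, smul_add] <;>
    module

/-- The vectors of the standard basis, in the Clifford algebra. -/
noncomputable def gen (q : IntForm 3) (i : Fin 3) : CliffordAlgebra q := CliffordAlgebra.ι q (Pi.single i 1)

theorem gen_sq (q : IntForm 3) (i : Fin 3) :
    gen q i * gen q i = q (Pi.single i 1) • (1 : CliffordAlgebra q) := by
  rw [gen, CliffordAlgebra.ι_sq_scalar, Algebra.algebraMap_eq_smul_one]

theorem gen_swap (q : IntForm 3) (i j : Fin 3) :
    gen q j * gen q i = formMatrix q i j • (1 : CliffordAlgebra q) - gen q i * gen q j := by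
  rw [eq_sub_iff_add_eq, add_comm, gen, gen, CliffordAlgebra.ι_mul_ι_add_swap,
    Algebra.algebraMap_eq_smul_one, formMatrix_apply]

/-- The family `1, e₀e₁, e₀e₂, e₁e₂` in the even Clifford algebra. -/
noncomputable def evenFamily (q : IntForm 3) : Fin 4 → CliffordAlgebra.even q :=
  ![1, (CliffordAlgebra.even.ι q).bilin (Pi.single 0 1) (Pi.single 1 1),
    (CliffordAlgebra.even.ι q).bilin (Pi.single 0 1) (Pi.single 2 1),
    (CliffordAlgebra.even.ι q).bilin (Pi.single 1 1) (Pi.single 2 1)]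

theorem coe_sum_evenFamily (q : IntForm 3) (x : Fin 4 → ℤ) :
    ((∑ i, x i • evenFamily q i : CliffordAlgebra.even q) : CliffordAlgebra q) =
      x 0 • (1 : CliffordAlgebra q) + x 1 • (gen q 0 * gen q 1) + x 2 • (gen q 0 * gen q 2) +
        x 3 • (gen q 1 * gen q 2) := by
  rw [Fin.sum_univ_four]
  rfl

/-- The first column of left multiplication is the image of `1`, that is, the coordinate vector
itself. -/
theorem even_lift_sum (q : IntForm 3) (x : Fin 4 → ℤ) (i : Fin 4) :
    (CliffordAlgebra.even.lift q (evenHom q) (∑ i, x i • evenFamily q i)) i 0 = x i := by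
  rw [map_sum, Matrix.sum_apply]
  simp only [map_zsmul, Matrix.smul_apply, Fin.sum_univ_four, evenFamily, Matrix.cons_val,
    map_one, CliffordAlgebra.even.lift_ι, evenHom, evenMulBilin, LinearMap.mk₂_apply]
  fin_cases i
  · simp [evenMul]
    exact mul_one (x 0)
  all_goals simp [evenMul]

/-- The span contains the scalars and is stable under left multiplication by products of two
vectors, which generate the even part. -/
theorem mem_span_evenFamily (q : IntForm 3) (x : CliffordAlgebra q)
    (hx : x ∈ CliffordAlgebra.evenOdd q 0) : ∃ y : Fin 4 → ℤ, x = y 0 • (1 : CliffordAlgebra q) +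
      y 1 • (gen q 0 * gen q 1) + y 2 • (gen q 0 * gen q 2) + y 3 • (gen q 1 * gen q 2) := by
  obtain ⟨⟨h1, h2, h3⟩, ⟨h4, h5, h6⟩, ⟨h7, h8, h9⟩, -⟩ :=
    mul_relations (gen_sq q 0) (gen_sq q 1) (gen_sq q 2)
      (gen_swap q 0 1) (gen_swap q 0 2) (gen_swap q 1 2)
  induction x, hx using CliffordAlgebra.even_induction with
  | algebraMap r => exact ⟨![r, 0, 0, 0], by simp⟩
  | add x y hx hy ihx ihy =>
    obtain ⟨x', rfl⟩ := ihx
    obtain ⟨y', rfl⟩ := ihy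
    exact ⟨x' + y', by simp only [Pi.add_apply]; module⟩
  | ι_mul_ι_mul m₁ m₂ x hx ih =>
    obtain ⟨y, rfl⟩ := ih
    have hι : ∀ m : Fin 3 → ℤ, CliffordAlgebra.ι q m =
        m 0 • gen q 0 + m 1 • gen q 1 + m 2 • gen q 2 := by
      intro m
      simp only [gen]
      rw [← map_zsmul, ← map_zsmul, ← map_zsmul, ← map_add, ← map_add]
      congr 1
      ext i; fin_cases i <;> simp
    obtain ⟨s, k, l, n, hm⟩ : ∃ s k l n : ℤ, CliffordAlgebra.ι q m₁ * CliffordAlgebra.ι q m₂ =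
        s • (1 : CliffordAlgebra q) + k • (gen q 0 * gen q 1) + l • (gen q 0 * gen q 2) +
          n • (gen q 1 * gen q 2) := by
      refine ⟨m₁ 0 * m₂ 0 * q (Pi.single 0 1) + m₁ 1 * m₂ 1 * q (Pi.single 1 1) +
        m₁ 2 * m₂ 2 * q (Pi.single 2 1) + m₁ 1 * m₂ 0 * formMatrix q 0 1 +
        m₁ 2 * m₂ 0 * formMatrix q 0 2 + m₁ 2 * m₂ 1 * formMatrix q 1 2,
        m₁ 0 * m₂ 1 - m₁ 1 * m₂ 0, m₁ 0 * m₂ 2 - m₁ 2 * m₂ 0, m₁ 1 * m₂ 2 - m₁ 2 * m₂ 1, ?_⟩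
      rw [hι, hι]
      simp only [mul_add, add_mul, mul_smul_comm, smul_mul_assoc, gen_sq, gen_swap q 0 1,
        gen_swap q 0 2, gen_swap q 1 2]
      module
    rw [hm]
    simp only [mul_add, add_mul, mul_smul_comm, smul_mul_assoc, mul_one, one_mul,
      h1, h2, h3, h4, h5, h6, h7, h8, h9]
    generalize gen q 0 * gen q 1 = XY, gen q 0 * gen q 2 = XZ, gen q 1 * gen q 2 = YZ,
      q (Pi.single 0 1) = a, q (Pi.single 1 1) = b, q (Pi.single 2 1) = c,
      formMatrix q 1 2 = u, formMatrix q 0 2 = v, formMatrix q 0 1 = w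
    -- The coordinates of the product, read off the multiplication table `h1`–`h9`.
    refine ⟨![s * y 0 - a * b * (k * y 1) + (-a * u * y 1 - a * c * y 2) * l +
      ((v * b - w * u) * y 1 - c * w * y 2 - b * c * y 3) * n,
      s * y 1 + k * y 0 + k * w * y 1 + l * (v * y 1 - c * y 3) + n * (u * y 1 + c * y 2),
      s * y 2 + k * (w * y 2 + b * y 3) + l * (y 0 + v * y 2 + u * y 3) - n * b * y 1,
      s * y 3 - k * a * y 2 + l * a * y 1 + n * (y 0 + w * y 1 + v * y 2 + u * y 3)], ?_⟩
    simp only [Matrix.cons_val]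
    module

/-- The basis `1, e₀e₁, e₀e₂, e₁e₂` of the even Clifford algebra. -/
noncomputable def evenBasis (q : IntForm 3) : Module.Basis (Fin 4) ℤ (CliffordAlgebra.even q) :=
  Module.Basis.mk (v := evenFamily q)
    (by
      rw [Fintype.linearIndependent_iff]
      intro g hg i
      rw [← even_lift_sum q g i, hg, map_zero]
      rfl)
    (by
      rintro ⟨x, hx⟩ -
      obtain ⟨y, hy⟩ := mem_span_evenFamily q x hx
      have : (⟨x, hx⟩ : CliffordAlgebra.even q) = ∑ i, y i • evenFamily q i :=
        Subtype.ext (hy.trans (coe_sum_evenFamily q y).symm)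
      rw [this]
      exact Submodule.sum_mem _ fun i _ =>
        Submodule.smul_mem _ _ (Submodule.subset_span ⟨i, rfl⟩))

theorem evenBasis_apply (q : IntForm 3) (i : Fin 4) : evenBasis q i = evenFamily q i := by
  rw [evenBasis, Module.Basis.mk_apply]

/-- The norm form in the basis `1, e₀e₁, e₀e₂, e₁e₂`. -/
noncomputable def stdNormForm (a b c u v w : ℤ) : IntForm 4 :=
  Matrix.toQuadraticForm' !![1, w, v, u; 0, a * b, u * a, u * w - b * v; 0, 0, a * c, c * w;
    0, 0, 0, b * c]

theorem stdNormForm_apply (a b c u v w : ℤ) (x : Fin 4 → ℤ) : stdNormForm a b c u v w x =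
    x 0 * x 0 + w * x 0 * x 1 + v * x 0 * x 2 + u * x 0 * x 3 + a * b * x 1 * x 1 +
      a * c * x 2 * x 2 + b * c * x 3 * x 3 + u * a * x 1 * x 2 + (u * w - b * v) * x 1 * x 3 +
      c * w * x 2 * x 3 := by
  rw [stdNormForm, Matrix.toQuadraticForm', LinearMap.BilinMap.toQuadraticMap_apply,
    Matrix.toLinearMap₂'_apply']
  simp [dotProduct, mulVec, Fin.sum_univ_four]
  ring

theorem formMatrix_stdNormForm (a b c u v w : ℤ) : formMatrix (stdNormForm a b c u v w) =
    !![2, w, v, u; w, 2 * a * b, u * a, u * w - b * v; v, u * a, 2 * a * c, c * w;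
      u, u * w - b * v, c * w, 2 * b * c] := by
  ext i j
  rw [formMatrix_apply, QuadraticMap.polar, stdNormForm_apply, stdNormForm_apply,
    stdNormForm_apply]
  fin_cases i <;> fin_cases j <;> simp <;> ring

theorem formDet_stdNormForm (a b c u v w : ℤ) : formDet (stdNormForm a b c u v w) =
    (4 * a * b * c + u * v * w - a * u ^ 2 - b * v ^ 2 - c * w ^ 2) ^ 2 := by
  rw [formDet, formMatrix_stdNormForm, det_succ_row_zero]
  simp [Fin.sum_univ_succ, det_fin_three, Fin.succAbove, submatrix]
  ring

theorem formDet_three (q : IntForm 3) : formDet q =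
    2 * (4 * q (Pi.single 0 1) * q (Pi.single 1 1) * q (Pi.single 2 1) +
      formMatrix q 1 2 * formMatrix q 0 2 * formMatrix q 0 1 -
      q (Pi.single 0 1) * formMatrix q 1 2 ^ 2 - q (Pi.single 1 1) * formMatrix q 0 2 ^ 2 -
      q (Pi.single 2 1) * formMatrix q 0 1 ^ 2) := by
  rw [formDet, det_fin_three]
  simp only [formMatrix_self, formMatrix_comm q 1 0, formMatrix_comm q 2 0, formMatrix_comm q 2 1]
  ring

/-- The norm form of the even Clifford algebra in the basis `1, e₀e₁, e₀e₂, e₁e₂`. -/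
noncomputable def evenNormForm (q : IntForm 3) : IntForm 4 :=
  stdNormForm (q (Pi.single 0 1)) (q (Pi.single 1 1)) (q (Pi.single 2 1)) (formMatrix q 1 2)
    (formMatrix q 0 2) (formMatrix q 0 1)

theorem algebraMap_evenNormForm (q : IntForm 3) (x : Fin 4 → ℤ) :
    algebraMap ℤ (CliffordAlgebra q) (evenNormForm q x) =
      ((∑ i, x i • evenBasis q i : CliffordAlgebra.even q) : CliffordAlgebra q) *
        star ((∑ i, x i • evenBasis q i : CliffordAlgebra.even q) : CliffordAlgebra q) := by
  simp only [evenBasis_apply]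
  rw [coe_sum_evenFamily]
  have hstar : ∀ i j, star (gen q i * gen q j) = gen q j * gen q i := fun i j => by
    rw [star_mul, gen, gen, CliffordAlgebra.star_ι, CliffordAlgebra.star_ι, neg_mul_neg]
  rw [star_add, star_add, star_add, CliffordAlgebra.star_smul, CliffordAlgebra.star_smul,
    CliffordAlgebra.star_smul, CliffordAlgebra.star_smul, star_one, hstar, hstar, hstar,
    (mul_relations (gen_sq q 0) (gen_sq q 1) (gen_sq q 2)
      (gen_swap q 0 1) (gen_swap q 0 2) (gen_swap q 1 2)).2.2.2, Algebra.algebraMap_eq_smul_one, evenNormForm, stdNormForm_apply]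

theorem isEvenNormForm_evenNormForm (q : IntForm 3) : IsEvenNormForm q (evenNormForm q) :=
  ⟨evenBasis q, algebraMap_evenNormForm q⟩

/-- An integer is recovered as the `(0, 0)` entry of its image under the matrix representation. -/
theorem algebraMap_clifford_injective (q : IntForm 3) :
    Function.Injective (algebraMap ℤ (CliffordAlgebra q)) := by
  intro r s h
  have h' : algebraMap ℤ (CliffordAlgebra.even q) r = algebraMap ℤ (CliffordAlgebra.even q) s :=
    Subtype.ext h
  have h2 := congrArg (fun x => (CliffordAlgebra.even.lift q (evenHom q) x) 0 0) h'
  simp only [AlgHom.commutes, Matrix.algebraMap_matrix_apply] at h2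
  simpa using h2

/-- Bases differ by a unimodular matrix, which leaves the determinant unchanged, so the explicit
norm form decides. -/
theorem formDet_of_isEvenNormForm {q : IntForm 3} {n : IntForm 4} (h : IsEvenNormForm q n) {Δ : ℤ}
    (hΔ : formDet q = 2 * Δ) : formDet n = Δ ^ 2 := by
  obtain ⟨b, hb⟩ := h
  have hn : n = subst (evenNormForm q) ((evenBasis q).toMatrix b) := by
    ext x
    apply algebraMap_clifford_injective q
    rw [hb, subst_apply, algebraMap_evenNormForm]
    have : ∑ i, x i • b i = ∑ i, ((evenBasis q).toMatrix b *ᵥ x) i • evenBasis q i := by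
      simp only [mulVec, dotProduct, Finset.sum_smul]
      rw [Finset.sum_comm]
      refine Finset.sum_congr rfl fun j _ => ?_
      rw [← (evenBasis q).sum_toMatrix_smul_self b j, Finset.smul_sum]
      exact Finset.sum_congr rfl fun i _ => by rw [smul_smul, mul_comm]
    rw [this]
  have hU : (evenBasis q).toMatrix b ∈ intGL 4 := isUnit_toMatrix_basis _ _
  rw [hn, formDet_subst, det_sq_of_mem_intGL hU, one_mul, evenNormForm, formDet_stdNormForm]
  rw [formDet_three] at hΔ
  rw [mul_left_cancel₀ two_ne_zero hΔ]

end NormForm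

end Automorph

/-! ### Assembly of the theorem. -/

theorem theorem6p3 {ι κ : Type*} (q : IntForm 3) (Δ : ℤ) (hΔ : formDet q = 2 * Δ)
    (hq : formDet q ≠ 0) (p : ℕ) [Fact p.Prime] (hp : ¬ (p : ℤ) ∣ 2 * Δ)
    (qs : ι → IntForm 3) (hqs : IsCompleteSystem q qs) :
    (∃ n : IntForm 4, IsEvenNormForm q n) ∧
    ∀ n : IntForm 4, IsEvenNormForm q n →
    ∀ ns : κ → IntForm 4, IsCompleteSystem n ns →
      formChar n p = legendreSym p ((-1) ^ 2 * Δ ^ 2) ∧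
      (primAutomorphClasses q ((p : ℤ) ^ 2) qs).Finite ∧
      (automorphClasses n (p : ℤ) ns).Finite ∧
      ((primAutomorphClasses q ((p : ℤ) ^ 2) qs).ncard : ℚ) =
        (1 + (formChar n p : ℚ))⁻¹ * ((automorphClasses n (p : ℤ) ns).ncard : ℚ) ∧
      (primAutomorphClasses q ((p : ℤ) ^ 2) qs).encard =
        isotropicSum ((p : ℤ) ^ 2) q (Matrix.diagonal ![1, (p : ℤ), (p : ℤ) ^ 2])
          (0 : Matrix (Fin 3) (Fin 3) ℤ) ∧
      isotropicSum ((p : ℤ) ^ 2) q (Matrix.diagonal ![1, (p : ℤ), (p : ℤ) ^ 2])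
          (0 : Matrix (Fin 3) (Fin 3) ℤ) = (p : ℕ∞) + 1 ∧
      (automorphClasses n (p : ℤ) ns).encard =
        isotropicSum (p : ℤ) n (Matrix.diagonal ![1, 1, (p : ℤ), (p : ℤ)])
          (0 : Matrix (Fin 4) (Fin 4) ℤ) ∧
      isotropicSum (p : ℤ) n (Matrix.diagonal ![1, 1, (p : ℤ), (p : ℤ)])
          (0 : Matrix (Fin 4) (Fin 4) ℤ) = 2 * ((p : ℕ∞) + 1) := by
  refine ⟨⟨_, isEvenNormForm_evenNormForm q⟩, fun n hn ns hns => ?_⟩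
  have hpr : p.Prime := Fact.out
  have hpp : Prime (p : ℤ) := Nat.prime_iff_prime_int.1 hpr
  have hp0 : (p : ℤ) ≠ 0 := hpp.ne_zero
  have hp2 : p ≠ 2 := by
    rintro rfl
    exact hp (Dvd.intro _ rfl)
  have hpΔ : ¬ (p : ℤ) ∣ Δ := fun h => hp (h.mul_left 2)
  have hqp : ¬ (p : ℤ) ∣ formDet q := hΔ ▸ hp
  have hnΔ := formDet_of_isEvenNormForm hn hΔ
  have hnp : ¬ (p : ℤ) ∣ formDet n := by
    rw [hnΔ]
    exact fun h => hpΔ (hpp.dvd_of_dvd_pow h)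
  have hchar : formChar n p = legendreSym p ((-1) ^ 2 * Δ ^ 2) := by rw [formChar, hnΔ]
  have hchar1 : formChar n p = 1 := by
    rw [hchar, neg_one_sq, one_mul, legendreSym.sq_one' p]
    rwa [Ne, ZMod.intCast_zmod_eq_zero_iff_dvd]
  have hprim : (primAutomorphClasses q ((p : ℤ) ^ 2) qs).encard =
      isotropicSum ((p : ℤ) ^ 2) q (Matrix.diagonal ![1, (p : ℤ), (p : ℤ) ^ 2])
        (0 : Matrix (Fin 3) (Fin 3) ℤ) := by
    refine encard_classes_eq_isotropicSum (pow_ne_zero 2 hp0)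
      ((Prime.coprime_iff_not_dvd hpp).2 hqp).pow_left ?_
      (fun M => ∀ d : ℤ, (∀ i j, d ∣ M i j) → IsUnit d)
      (fun M f hf hM hP => mem_double_coset_of_primReps hqp hf ⟨hM, hP⟩) ?_ hqs
    · simp [Matrix.det_diagonal, Fin.prod_univ_three]
      ring
    -- A common divisor of the entries of `U D V` divides those of `D = U⁻¹ (U D V) V⁻¹`, one of
    -- which is `1`.
    · intro U hU V hV d hd
      obtain ⟨A, -, -, hAU⟩ := exists_intGL_inv hU
      obtain ⟨B, -, hVB, -⟩ := exists_intGL_inv hV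
      have hD : A * (U * Matrix.diagonal ![1, (p : ℤ), (p : ℤ) ^ 2] * V) * B =
          Matrix.diagonal ![1, (p : ℤ), (p : ℤ) ^ 2] := by
        rw [Matrix.mul_assoc U, ← Matrix.mul_assoc A, hAU, Matrix.one_mul, Matrix.mul_assoc, hVB,
          Matrix.mul_one]
      have h1 := congrFun (congrFun hD 0) 0
      rw [Matrix.diagonal_apply_eq] at h1
      refine isUnit_of_dvd_one ?_
      change d ∣ ![1, (p : ℤ), (p : ℤ) ^ 2] 0
      rw [← h1, Matrix.mul_apply]
      refine Finset.dvd_sum fun j _ => dvd_mul_of_dvd_left ?_ _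
      rw [Matrix.mul_apply]
      exact Finset.dvd_sum fun k _ => dvd_mul_of_dvd_right (hd k j) _
  have haut : (automorphClasses n (p : ℤ) ns).encard =
      isotropicSum (p : ℤ) n (Matrix.diagonal ![1, 1, (p : ℤ), (p : ℤ)])
        (0 : Matrix (Fin 4) (Fin 4) ℤ) := by
    have := encard_classes_eq_isotropicSum hp0 ((Prime.coprime_iff_not_dvd hpp).2 hnp)
      (D := Matrix.diagonal ![1, 1, (p : ℤ), (p : ℤ)])
      (by simp [Matrix.det_diagonal, Fin.prod_univ_four]; ring) (fun _ => True)
      (fun M f hf hM _ => mem_double_coset_of_reps hnp hf hM) (fun _ _ _ _ => trivial) hns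
    simpa only [and_true, automorphClasses] using this
  have h3 := isotropicSum_ternary hp2 hqp
  have h4 := isotropicSum_quaternary hp2 hnΔ hpΔ
  have hprim' : (primAutomorphClasses q ((p : ℤ) ^ 2) qs).encard = ((p + 1 : ℕ) : ℕ∞) := by
    rw [hprim, h3]; push_cast; rfl
  have haut' : (automorphClasses n (p : ℤ) ns).encard = ((2 * (p + 1) : ℕ) : ℕ∞) := by
    rw [haut, h4]; push_cast; rfl
  refine ⟨hchar, Set.finite_of_encard_eq_coe hprim', Set.finite_of_encard_eq_coe haut', ?_, hprim,
    h3, haut, h4⟩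
  rw [Set.ncard, Set.ncard, hprim', haut', hchar1, ENat.toNat_natCast, ENat.toNat_natCast]
  push_cast
  ring
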